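/- Consider the scale mixture of skew-normal linear mixed model for one subject with $n\ge 1$ observations, $l$ fixed and $q$ random effects. Let $X\in\mathbb R^{n\times l}$, $Z\in\mathbb R^{n\times q}$, $\beta\in\mathbb R^l$, $\lambda\in\mathbb R^q$, $\Sigma=\sigma_e^2R$ with $\sigma_e^2>0$ and $R\in\mathbb R^{n\times n}$ symmetric positive definite, $D\in\mathbb R^{q\times q}$ symmetric positive definite, and let $H$ be a probability distribution on $(0,\infty)$ with $k_1=\int u^{-1/2}\,dH(u)<\infty$. Powers $^{\pm1/2}$ of positive definite matrices denote the symmetric positive definite ones. Put $$c=-\sqrt{2/\pi}\,k_1,\quad \delta=\frac{\lambda}{\sqrt{1+\lambda^\top\lambda}},\quad \Delta=D^{1/2}\delta,\quad \Gamma=D-\Delta\Delta^\top .$$ Let $TN(m,v;I)$ be the normal distribution $N(m,v)$ truncated to (conditioned on) $I$. Let $U,T$ be real-valued and $b,Y$ be $\mathbb R^q$- and $\mathbb R^n$-valued random variables on one probability space with $$U\sim H,\qquad T\mid U=u\sim TN(c,u^{-1};(c,\infty)),\qquad b\mid T=t,U=u\sim N_q(\Delta t,u^{-1}\Gamma),$$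 $$Y\mid b,T,U=u\sim N_n(X\beta+Zb,u^{-1}\Sigma).$$ Define $\Omega=\Sigma+Z\Gamma Z^\top$, $\Psi=\Sigma+ZDZ^\top$, $M=(1+\Delta^\top Z^\top\Omega^{-1}Z\Delta)^{-1/2}$, $B=(\Gamma^{-1}+Z^\top\Sigma^{-1}Z)^{-1}$, $s=(I_q-BZ^\top\Sigma^{-1}Z)\Delta$ and, for $y\in\mathbb R^n$, $\mu=\mu(y)=M^2\Delta^\top Z^\top\Omega^{-1}(y-X\beta-cZ\Delta)$, $r=r(y)=BZ^\top\Sigma^{-1}(y-X\beta)$, $A=A(y)=\mu/M$. Further let $\zeta=D^{-1/2}\lambda$, $\Lambda=(D^{-1}+Z^\top\Sigma^{-1}Z)^{-1}$ and $\bar\lambda=\Psi^{-1/2}ZD\zeta/\sqrt{1+\zeta^\top\Lambda\zeta}$. Let $\Phi$ and $\phi_1$ be the standard normal cdf and pdf, $W_\Phi=\phi_1/\Phi$, and let $\phi_n(\cdot\,;m,S)$ be the density of $N_n(m,S)$. Then: 1. $b\mid T=t,U=u,Y=y\ \sim\ N_q(s\,t+r,\;u^{-1}B)$. 2. $T\mid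 U=u,Y=y\ \sim\ TN(c+\mu,\;u^{-1}M^2;\;(c,\infty))$. 3. $Y\sim \mathrm{SMSN}_n(X\beta+cZ\Delta,\Psi,\bar\lambda;H)$, i.e. $Y$ has the density $$y\mapsto 2\int_0^\infty\phi_n(y;X\beta+cZ\Delta,u^{-1}\Psi)\,\Phi\big(u^{1/2}\bar\lambda^\top\Psi^{-1/2}(y-X\beta-cZ\Delta)\big)\,dH(u).$$ 4. $A(y)=\bar\lambda^\top\Psi^{-1/2}(y-X\beta-cZ\Delta)$ for all $y\in\mathbb R^n$. 5. For almost every $y$ (with respect to the law of $Y$) the conditional expectations given $Y=y$ $$\hat u=E[U\mid y],\quad \widehat{ut}=E[UT\mid y],\quad \widehat{ut^2}=E[UT^2\mid y],\quad \widehat{ub}=E[Ub\mid y],\quad \widehat{utb}=E[UTb\mid y],$$ $$\widehat{ub^2}=E[Ubb^\top\mid y],\qquad \hat\tau_1=E[U^{1/2}W_\Phi(U^{1/2}A)\mid y]$$ (integrals with respect to the regular conditional distribution of $(U,T,b)$ given $Y=y$) exist and are finite, and $$\widehat{ut}=(\mu+c)\hat u+M\hat\tau_1,\qquad \widehat{ut^2}=M^2+(\mu+c)^2\hat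 u+M(\mu+2c)\hat\tau_1,$$ $$\widehat{ub}=r\,\hat u+s\,\widehat{ut},\qquad \widehat{utb}=r\,\widehat{ut}+s\,\widehat{ut^2},$$ $$\widehat{ub^2}=B+\hat u\,rr^\top+\widehat{ut}\,(sr^\top+rs^\top)+\widehat{ut^2}\,ss^\top .$$ Statements about conditional distributions hold for almost every value of the conditioning variables. -/

import Mathlib

open MeasureTheory ProbabilityTheory Set
open scoped Matrix MatrixOrder

noncomputable section

/-! ### Distributions -/

/-- The regular conditional distribution of `V` given `W = w` is `κ w`, for almost every value `w`
of `W`. -/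
def CondLaw {Ω S E : Type*} [MeasurableSpace Ω] [MeasurableSpace S] [MeasurableSpace E]
    [StandardBorelSpace E] [Nonempty E] (V : Ω → E) (W : Ω → S) (P : Measure Ω)
    [IsFiniteMeasure P] (κ : S → Measure E) : Prop :=
  ∀ᵐ w ∂(P.map W), condDistrib V W P w = κ w

/-- `TN(m, v; I)`: the normal distribution with mean `m` and variance `v`, truncated to `I`
(that is, conditioned on `I`). -/
def truncNormal (m v : ℝ) (I : Set ℝ) : Measure ℝ :=
  ProbabilityTheory.cond (gaussianReal m v.toNNReal) I

/-- Density of the `p`-variate normal distribution with mean `m` and covariance matrix `S`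
(for positive definite `S`). -/
def normalPDF {p : ℕ} (m : Fin p → ℝ) (S : Matrix (Fin p) (Fin p) ℝ) (y : Fin p → ℝ) : ℝ :=
  (Real.sqrt ((2 * Real.pi) ^ p * S.det))⁻¹ * Real.exp (-((y - m) ⬝ᵥ (S⁻¹ *ᵥ (y - m))) / 2)

/-- Standard normal cumulative distribution function. -/
def stdNormalCDF (x : ℝ) : ℝ := cdf (gaussianReal 0 1) x

/-- `W_Φ(x) = φ₁(x) / Φ(x)`. -/
def WPhi (x : ℝ) : ℝ := gaussianPDFReal 0 1 x / stdNormalCDF x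

/-- Density of the scale mixture of skew-normal distributions `SMSN_p(m, S, lam; H)` with weight
function `κ(u) = u⁻¹`; it may take the value `∞` on a null set. -/
def smsnPDF {p : ℕ} (m : Fin p → ℝ) (S : Matrix (Fin p) (Fin p) ℝ) (lam : Fin p → ℝ)
    (H : Measure ℝ) (y : Fin p → ℝ) : ENNReal :=
  2 * ∫⁻ u in Ioi (0 : ℝ), ENNReal.ofReal
    (normalPDF m (u⁻¹ • S) y *
      stdNormalCDF (Real.sqrt u * (lam ⬝ᵥ ((CFC.sqrt S)⁻¹ *ᵥ (y - m))))) ∂H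

/-- The distribution `SMSN_p(m, S, lam; H)`. -/
def smsn {p : ℕ} (m : Fin p → ℝ) (S : Matrix (Fin p) (Fin p) ℝ) (lam : Fin p → ℝ)
    (H : Measure ℝ) : Measure (EuclideanSpace ℝ (Fin p)) :=
  volume.withDensity fun y => smsnPDF m S lam H y.ofLp

/-! ### The linear mixed model of one subject -/

/-- Design matrices and parameters of the scale mixture of skew-normal linear mixed model, for one
subject with `n` observations, `l` fixed effects and `q` random effects. `H` is the distribution of
the mixing variable; `integrable_k1` says that `k₁ = E[U^{-1/2}]`, hence `c`, is finite. -/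
structure SMSNLMM (n l q : ℕ) where
  X : Matrix (Fin n) (Fin l) ℝ
  Z : Matrix (Fin n) (Fin q) ℝ
  β : Fin l → ℝ
  sigmaSq : ℝ
  sigmaSq_pos : 0 < sigmaSq
  R : Matrix (Fin n) (Fin n) ℝ
  R_posDef : R.PosDef
  D : Matrix (Fin q) (Fin q) ℝ
  D_posDef : D.PosDef
  lam : Fin q → ℝ
  H : Measure ℝ
  H_prob : IsProbabilityMeasure H
  H_pos : ∀ᵐ u ∂H, 0 < u
  integrable_k1 : Integrable (fun u : ℝ => u ^ (-(1 / 2) : ℝ)) H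

namespace SMSNLMM

variable {n l q : ℕ} (θ : SMSNLMM n l q)

/-- `Σ = σₑ² R`. -/
def Sig : Matrix (Fin n) (Fin n) ℝ := θ.sigmaSq • θ.R

/-- `k₁ = E[U^{-1/2}]`. -/
def k1 : ℝ := ∫ u, u ^ (-(1 / 2) : ℝ) ∂θ.H

/-- `c = -√(2/π) k₁`. -/
def c : ℝ := -Real.sqrt (2 / Real.pi) * θ.k1

/-- `δ = λ / √(1 + λᵀλ)`. -/
def delta : Fin q → ℝ := (Real.sqrt (1 + θ.lam ⬝ᵥ θ.lam))⁻¹ • θ.lam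

/-- `Δ = D^{1/2} δ`. -/
def Delta : Fin q → ℝ := CFC.sqrt θ.D *ᵥ θ.delta

/-- `Γ = D - Δ Δᵀ`. -/
def Gam : Matrix (Fin q) (Fin q) ℝ := θ.D - Matrix.vecMulVec θ.Delta θ.Delta

/-- `Ω = Σ + Z Γ Zᵀ`. -/
def Omega : Matrix (Fin n) (Fin n) ℝ := θ.Sig + θ.Z * θ.Gam * θ.Zᵀ

/-- `Ψ = Σ + Z D Zᵀ`. -/
def Psi : Matrix (Fin n) (Fin n) ℝ := θ.Sig + θ.Z * θ.D * θ.Zᵀ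

/-- `ζ = D^{-1/2} λ`. -/
def zeta : Fin q → ℝ := (CFC.sqrt θ.D)⁻¹ *ᵥ θ.lam

/-- `Λ = (D⁻¹ + Zᵀ Σ⁻¹ Z)⁻¹`. -/
def Lam : Matrix (Fin q) (Fin q) ℝ := (θ.D⁻¹ + θ.Zᵀ * θ.Sig⁻¹ * θ.Z)⁻¹

/-- `λ̄ = Ψ^{-1/2} Z D ζ / √(1 + ζᵀ Λ ζ)`. -/
def lamBar : Fin n → ℝ :=
  (Real.sqrt (1 + θ.zeta ⬝ᵥ (θ.Lam *ᵥ θ.zeta)))⁻¹ •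
    ((CFC.sqrt θ.Psi)⁻¹ *ᵥ (θ.Z *ᵥ (θ.D *ᵥ θ.zeta)))

/-- The location `X β + c Z Δ` of `Y`. -/
def loc : Fin n → ℝ := θ.X *ᵥ θ.β + θ.c • (θ.Z *ᵥ θ.Delta)

/-- `M = (1 + Δᵀ Zᵀ Ω⁻¹ Z Δ)^{-1/2}`. -/
def M : ℝ :=
  (1 + (θ.Z *ᵥ θ.Delta) ⬝ᵥ (θ.Omega⁻¹ *ᵥ (θ.Z *ᵥ θ.Delta))) ^ (-(1 / 2) : ℝ)

/-- `μ = M² Δᵀ Zᵀ Ω⁻¹ (y - X β - c Z Δ)`. -/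
def mu (y : Fin n → ℝ) : ℝ :=
  θ.M ^ 2 * ((θ.Z *ᵥ θ.Delta) ⬝ᵥ (θ.Omega⁻¹ *ᵥ (y - θ.loc)))

/-- `B = (Γ⁻¹ + Zᵀ Σ⁻¹ Z)⁻¹`. -/
def B : Matrix (Fin q) (Fin q) ℝ := (θ.Gam⁻¹ + θ.Zᵀ * θ.Sig⁻¹ * θ.Z)⁻¹

/-- `s = (I - B Zᵀ Σ⁻¹ Z) Δ`. -/
def s : Fin q → ℝ := (1 - θ.B * θ.Zᵀ * θ.Sig⁻¹ * θ.Z) *ᵥ θ.Delta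

/-- `r = B Zᵀ Σ⁻¹ (y - X β)`. -/
def r (y : Fin n → ℝ) : Fin q → ℝ := (θ.B * θ.Zᵀ * θ.Sig⁻¹) *ᵥ (y - θ.X *ᵥ θ.β)

/-- `A = μ / M`. -/
def A (y : Fin n → ℝ) : ℝ := θ.mu y / θ.M

/-- The hierarchical model: `U ∼ H`, `T | U = u ∼ TN(c, u⁻¹; (c, ∞))`,
`b | T = t, U = u ∼ N_q(Δ t, u⁻¹ Γ)` and `Y | b, T, U = u ∼ N_n(X β + Z b, u⁻¹ Σ)`. -/
structure IsModel {Ω : Type*} [MeasurableSpace Ω] (P : Measure Ω) [IsProbabilityMeasure P]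
    (U T : Ω → ℝ) (b : Ω → EuclideanSpace ℝ (Fin q)) (Y : Ω → EuclideanSpace ℝ (Fin n)) :
    Prop where
  measurable_U : Measurable U
  measurable_T : Measurable T
  measurable_b : Measurable b
  measurable_Y : Measurable Y
  law_U : P.map U = θ.H
  law_T : CondLaw T U P fun u => truncNormal θ.c u⁻¹ (Ioi θ.c)
  law_b : CondLaw b (fun ω => (T ω, U ω)) P fun w =>
    multivariateGaussian (WithLp.toLp 2 (w.1 • θ.Delta)) (w.2⁻¹ • θ.Gam)
  law_Y : CondLaw Y (fun ω => (b ω, T ω, U ω)) P fun w =>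
    multivariateGaussian (WithLp.toLp 2 (θ.X *ᵥ θ.β + θ.Z *ᵥ w.1.ofLp)) (w.2.2⁻¹ • θ.Sig)

end SMSNLMM

/-! ### Conditional moments given `Y = y`

Below, `Q` stands for the conditional distribution of `(U, T, b)` given `Y = y`. -/

section Moments

variable {q : ℕ}

/-- The conditional distribution of `(U, T, b)` given `Y = y`. -/
def condLatent {Ω : Type*} [MeasurableSpace Ω] {n : ℕ} (P : Measure Ω) [IsFiniteMeasure P]
    (U T : Ω → ℝ) (b : Ω → EuclideanSpace ℝ (Fin q)) (Y : Ω → EuclideanSpace ℝ (Fin n))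
    (y : EuclideanSpace ℝ (Fin n)) : Measure (ℝ × ℝ × EuclideanSpace ℝ (Fin q)) :=
  condDistrib (fun ω => (U ω, T ω, b ω)) Y P y

variable (Q : Measure (ℝ × ℝ × EuclideanSpace ℝ (Fin q)))

/-- `E[U | y]`. -/
def uHat : ℝ := ∫ z, z.1 ∂Q

/-- `E[U T | y]`. -/
def utHat : ℝ := ∫ z, z.1 * z.2.1 ∂Q

/-- `E[U T² | y]`. -/
def utSqHat : ℝ := ∫ z, z.1 * z.2.1 ^ 2 ∂Q

/-- `E[U b | y]`. -/
def ubHat : Fin q → ℝ := fun j => ∫ z, z.1 * z.2.2 j ∂Q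

/-- `E[U T b | y]`. -/
def utbHat : Fin q → ℝ := fun j => ∫ z, z.1 * z.2.1 * z.2.2 j ∂Q

/-- `E[U b bᵀ | y]`. -/
def ubbHat : Matrix (Fin q) (Fin q) ℝ :=
  Matrix.of fun j k => ∫ z, z.1 * (z.2.2 j * z.2.2 k) ∂Q

/-- `τ₁ = E[U^{1/2} W_Φ(U^{1/2} a) | y]`, to be taken at `a = A`. -/
def tauOneHat (a : ℝ) : ℝ := ∫ z, Real.sqrt z.1 * WPhi (Real.sqrt z.1 * a) ∂Q

end Moments

end

noncomputable section

/-! ### Characteristic functions of composition products -/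

section Swap

open scoped RealInnerProductSpace
open WithLp

variable {E F : Type*} [NormedAddCommGroup E] [NormedAddCommGroup F]
  [InnerProductSpace ℝ E] [InnerProductSpace ℝ F] [MeasurableSpace E] [MeasurableSpace F]
  [CompleteSpace E] [CompleteSpace F] [SecondCountableTopology E] [SecondCountableTopology F]
  [BorelSpace E] [BorelSpace F]

/-! Given `U = u` the model is jointly Gaussian except that `T` is truncated to `(c, ∞)`. Bayes'
rule is therefore applied twice, each time to a Gaussian prior with a Gaussian linear likelihood. At
fixed `t`, the pair `(b, Y)` refactors as `Y ∼ N(Xβ + tZΔ, u⁻¹Ω)` and `b | Y ∼ N(st + r, u⁻¹B)`.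
Before truncation, `(T, Y)` refactors as `Y ∼ N(Xβ + cZΔ, u⁻¹Ψ)` and `T | Y ∼ N(c + μ, u⁻¹M²)`. The
prior of `T` is truncated at its mean, which costs the factor 2; the posterior puts mass `Φ(√u A)`
on `(c, ∞)`. Together these make the skew-normal density of `Y` given `u`.

Each exchange (`gaussian_compProd_swap`) is an equality of two joint laws, checked on characteristic
functions: it reduces to matching means and quadratic forms. The matching rests on matrix
identities: the gain satisfies `BZᵀΣ⁻¹Ω = ΓZᵀ`, and `Ψ` is a rank-one update of `Ω`, so that
Sherman–Morrison gives `M²Ω⁻¹ZΔ = Ψ⁻¹ZΔ`. Woodbury's formula for `Λ` then identifies `A` with the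
skewness term in `λ̄`.

The outcome is `IsModel.lintegral_eq`, a disintegration of the joint law in the order `U`, `Y`, `T`,
`b`. The conditional laws and the law of `Y` follow by Tonelli, and the posterior of `U` is `H`
reweighted by the density of `Y` given `u`. The moment identities integrate out `b` (Gaussian
moments), then `T` (truncated normal moments), then `U`.

Finiteness needs no moment of `H` beyond the model: away from the location of `Y`, the factor
`exp(-u d / 2)` with Mahalanobis distance `d > 0` dominates every power of `u`. The denominator of
`W_Φ` cancels against the factor `Φ` of the density, so its growth does no harm. -/

theorem measure_prod_ext_of_integral_exp {ξ ξ' : Measure (E × F)} [IsFiniteMeasure ξ]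
    [IsFiniteMeasure ξ']
    (h : ∀ x w, ∫ z, Complex.exp (⟪z.1, x⟫ * Complex.I) * Complex.exp (⟪z.2, w⟫ * Complex.I) ∂ξ
      = ∫ z, Complex.exp (⟪z.1, x⟫ * Complex.I) * Complex.exp (⟪z.2, w⟫ * Complex.I) ∂ξ') :
    ξ = ξ' := by
  refine (MeasurableEquiv.toLp 2 (E × F)).map_measurableEquiv_injective
      <| Measure.ext_of_charFun <| funext fun t ↦ ?_
  have := h (ofLp t).1 (ofLp t).2
  simp_rw [charFun, prod_inner_apply, integral_map_equiv]
  simpa [Complex.ofReal_add, add_mul, Complex.exp_add] using this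

/-- The two sides of `h` are the joint characteristic functions at `(x, w)` after the kernel
variable has been integrated out; Fubini applies because the exponentials have modulus at most one.
-/
theorem compProd_eq_map_swap_compProd {μ : Measure E} [IsProbabilityMeasure μ]
    {ν : Measure F} [IsProbabilityMeasure ν] {κ : Kernel E F} [IsMarkovKernel κ]
    {η : Kernel F E} [IsMarkovKernel η]
    (h : ∀ x w, ∫ e, Complex.exp (⟪e, x⟫ * Complex.I) * charFun (κ e) w ∂μ
      = ∫ f, Complex.exp (⟪f, w⟫ * Complex.I) * charFun (η f) x ∂ν) :
    μ ⊗ₘ κ = (ν ⊗ₘ η).map Prod.swap := by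
  have : IsProbabilityMeasure ((ν ⊗ₘ η).map Prod.swap) :=
    Measure.isProbabilityMeasure_map measurable_swap.aemeasurable
  have hb : ∀ x w, Measurable fun z : E × F =>
      Complex.exp (⟪z.1, x⟫ * Complex.I) * Complex.exp (⟪z.2, w⟫ * Complex.I) := by
    intro x w; fun_prop
  have hn : ∀ x w, ∀ z : E × F,
      ‖Complex.exp (⟪z.1, x⟫ * Complex.I) * Complex.exp (⟪z.2, w⟫ * Complex.I)‖ ≤ 1 := by
    intro x w z
    rw [norm_mul, Complex.norm_exp_ofReal_mul_I, Complex.norm_exp_ofReal_mul_I, one_mul]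
  refine measure_prod_ext_of_integral_exp fun x w => ?_
  rw [integral_map measurable_swap.aemeasurable (hb x w).aestronglyMeasurable,
    Measure.integral_compProd, Measure.integral_compProd]
  · have h1 := h x w
    simp only [Prod.fst_swap, Prod.snd_swap]
    simp_rw [integral_const_mul, integral_mul_const]
    simp only [charFun] at h1
    rw [h1]
    congr 1; ext f; rw [mul_comm]
  · exact Integrable.of_bound ((hb x w).comp measurable_swap).aestronglyMeasurable 1
      (Filter.Eventually.of_forall fun z => hn x w _)
  · exact Integrable.of_bound (hb x w).aestronglyMeasurable 1
      (Filter.Eventually.of_forall fun z => hn x w _)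

/-- Bayes' rule for a Gaussian location family with a Gaussian prior, in terms of characteristic
functions. -/
theorem gaussian_compProd_swap {μ : Measure E} [IsProbabilityMeasure μ]
    {ν : Measure F} [IsProbabilityMeasure ν] {κ : Kernel E F} [IsMarkovKernel κ]
    {η : Kernel F E} [IsMarkovKernel η]
    {m a' : E} {m' a : F} {L : E → F} {L' : F → E} {Ls : F → E} {Ls' : E → F}
    {R Q' : E → ℝ} {R' Q : F → ℝ}
    (hL : ∀ e w, ⟪L e, w⟫ = ⟪e, Ls w⟫) (hL' : ∀ f x, ⟪L' f, x⟫ = ⟪f, Ls' x⟫)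
    (hμ : ∀ x, charFun μ x = Complex.exp (⟪m, x⟫ * Complex.I - R x / 2))
    (hκ : ∀ e w, charFun (κ e) w = Complex.exp (⟪a + L e, w⟫ * Complex.I - Q w / 2))
    (hν : ∀ w, charFun ν w = Complex.exp (⟪m', w⟫ * Complex.I - R' w / 2))
    (hη : ∀ f x, charFun (η f) x = Complex.exp (⟪a' + L' f, x⟫ * Complex.I - Q' x / 2))
    (hm : a' + L' m' = m) (hm' : a + L m = m')
    (hq : ∀ x w, Q w + R (x + Ls w) = Q' x + R' (w + Ls' x)) :
    μ ⊗ₘ κ = (ν ⊗ₘ η).map Prod.swap := by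
  refine compProd_eq_map_swap_compProd fun x w => ?_
  -- Passing to the adjoint collects all dependence on `e` in one exponential, so that the integral
  -- becomes the characteristic function of `μ` at `x + Ls w`.
  have e1 : ∀ e, Complex.exp (⟪e, x⟫ * Complex.I) * charFun (κ e) w =
      Complex.exp (⟪a, w⟫ * Complex.I - Q w / 2) *
        Complex.exp (⟪e, x + Ls w⟫ * Complex.I) := by
    intro e
    rw [hκ, ← Complex.exp_add, ← Complex.exp_add, inner_add_left, inner_add_right, hL]
    push_cast; congr 1; ring
  have e2 : ∀ f, Complex.exp (⟪f, w⟫ * Complex.I) * charFun (η f) x =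
      Complex.exp (⟪a', x⟫ * Complex.I - Q' x / 2) *
        Complex.exp (⟪f, w + Ls' x⟫ * Complex.I) := by
    intro e
    rw [hη, ← Complex.exp_add, ← Complex.exp_add, inner_add_left, inner_add_right, hL']
    push_cast; congr 1; ring
  simp_rw [e1, e2, integral_const_mul]
  have h1 := hμ (x + Ls w)
  have h2 := hν (w + Ls' x)
  simp only [charFun] at h1 h2
  rw [h1, h2, ← Complex.exp_add, ← Complex.exp_add]
  congr 1
  have hq' : (Q w : ℂ) + R (x + Ls w) = Q' x + R' (w + Ls' x) := by exact_mod_cast hq x w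
  have i1 : (⟪a, w⟫ : ℝ) + ⟪m, x + Ls w⟫ = ⟪a', x⟫ + ⟪m', w + Ls' x⟫ := by
    rw [inner_add_right, inner_add_right, ← hL, ← hL']
    have h3 : ⟪m', w⟫ = ⟪a, w⟫ + ⟪L m, w⟫ := by rw [← inner_add_left, hm']
    have h4 : ⟪m, x⟫ = ⟪a', x⟫ + ⟪L' m', x⟫ := by rw [← inner_add_left, hm]
    rw [h3, h4]; ring
  have i1' : ((⟪a, w⟫ : ℝ) : ℂ) + (⟪m, x + Ls w⟫ : ℝ) = (⟪a', x⟫ : ℝ) + (⟪m', w + Ls' x⟫ : ℝ) := by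
    exact_mod_cast i1
  linear_combination Complex.I * i1' - hq' / 2

end Swap

/-! ### Conditional laws -/

theorem CondLaw.map_prodMk_eq {Ω S E : Type*} [MeasurableSpace Ω] [MeasurableSpace S]
    [MeasurableSpace E] [StandardBorelSpace E] [Nonempty E] {V : Ω → E} {W : Ω → S} {P : Measure Ω}
    [IsFiniteMeasure P] {κ : Kernel S E} [IsFiniteKernel κ] (h : CondLaw V W P κ)
    (hV : Measurable V) : P.map (fun ω => (W ω, V ω)) = P.map W ⊗ₘ κ := by
  rw [← condDistrib_ae_eq_iff_measure_eq_compProd W hV.aemeasurable]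
  exact h

theorem CondLaw.lintegral_prodMk {Ω S E : Type*} [MeasurableSpace Ω] [MeasurableSpace S]
    [MeasurableSpace E] [StandardBorelSpace E] [Nonempty E] {V : Ω → E} {W : Ω → S} {P : Measure Ω}
    [IsFiniteMeasure P] {κ : Kernel S E} [IsFiniteKernel κ] (h : CondLaw V W P κ)
    (hV : Measurable V) (hW : Measurable W) {f : S × E → ENNReal} (hf : Measurable f) :
    ∫⁻ ω, f (W ω, V ω) ∂P = ∫⁻ ω, ∫⁻ v, f (W ω, v) ∂(κ (W ω)) ∂P := by
  rw [← lintegral_map (f := f) (g := fun ω => (W ω, V ω)) hf (by fun_prop), h.map_prodMk_eq hV,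
    Measure.lintegral_compProd hf, lintegral_map _ hW]
  exact Measurable.lintegral_kernel_prod_right' hf

theorem CondLaw.of_lintegral {Ω S E : Type*} [MeasurableSpace Ω] [MeasurableSpace S]
    [MeasurableSpace E] [StandardBorelSpace E] [Nonempty E] {V : Ω → E} {W : Ω → S} {P : Measure Ω}
    [IsFiniteMeasure P] {κ : Kernel S E} [IsFiniteKernel κ]
    (hV : Measurable V) (hW : Measurable W)
    (h : ∀ f : S × E → ENNReal, Measurable f →
      ∫⁻ ω, f (W ω, V ω) ∂P = ∫⁻ ω, ∫⁻ v, f (W ω, v) ∂(κ (W ω)) ∂P) : CondLaw V W P κ := by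
  refine (condDistrib_ae_eq_iff_measure_eq_compProd W hV.aemeasurable κ).2 ?_
  refine Measure.ext_of_lintegral _ fun f hf => ?_
  rw [lintegral_map hf (by fun_prop), h f hf, Measure.lintegral_compProd hf, lintegral_map _ hW]
  exact Measurable.lintegral_kernel_prod_right' hf

/-! ### Positive definite matrices and their square roots -/

section Sqrt

variable {p : ℕ} {S : Matrix (Fin p) (Fin p) ℝ}

theorem posDef_sqrt (hS : S.PosDef) : (CFC.sqrt S).PosDef := by
  have h := (Matrix.nonneg_iff_posSemidef.1 (CFC.sqrt_nonneg S))
  refine h.posDef_iff_isUnit.2 ?_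
  have : CFC.sqrt S * CFC.sqrt S = S := CFC.sqrt_mul_sqrt_self S hS.posSemidef.nonneg
  have hu := hS.isUnit
  rw [← this] at hu
  exact isUnit_of_mul_isUnit_left hu

theorem sqrt_mul_sqrt (hS : S.PosDef) : CFC.sqrt S * CFC.sqrt S = S :=
  CFC.sqrt_mul_sqrt_self S hS.posSemidef.nonneg

theorem transpose_sqrt (S : Matrix (Fin p) (Fin p) ℝ) : (CFC.sqrt S)ᵀ = CFC.sqrt S := by
  have h := (Matrix.nonneg_iff_posSemidef.1 (CFC.sqrt_nonneg S)).isHermitian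
  simpa [Matrix.IsHermitian, Matrix.conjTranspose_eq_transpose_of_trivial] using h

theorem Matrix.PosDef.transpose_eq (hS : S.PosDef) : Sᵀ = S := by
  have h := hS.isHermitian
  simpa [Matrix.IsHermitian, Matrix.conjTranspose_eq_transpose_of_trivial] using h

theorem isUnit_det_of_posDef (hS : S.PosDef) : IsUnit S.det :=
  (Matrix.isUnit_iff_isUnit_det S).1 hS.isUnit

/-- No sign condition on `g` is imposed because the Gaussian kernels have scale `u⁻¹` for every real
`u` and must be measurable everywhere. For `g < 0` both sides are zero by convention. -/
theorem sqrt_smul (hS : S.PosDef) (g : ℝ) :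
    CFC.sqrt (g • S) = Real.sqrt g • CFC.sqrt S := by
  rcases le_or_gt 0 g with hg | hg
  · refine (CFC.sqrt_eq_iff _ _ (hS.posSemidef.smul hg).nonneg
      ((posDef_sqrt hS).posSemidef.smul (Real.sqrt_nonneg g)).nonneg).2 ?_
    rw [smul_mul_smul_comm, Real.mul_self_sqrt hg, sqrt_mul_sqrt hS]
  · rw [Real.sqrt_eq_zero_of_nonpos hg.le, zero_smul]
    rcases isEmpty_or_nonempty (Fin p) with hp | ⟨⟨i⟩⟩
    · exact Subsingleton.elim _ _
    -- The functional calculus returns 0 on an element that is not nonnegative; a negative diagonal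
    -- entry shows that `g • S` is not.
    · refine cfcₙ_apply_of_not_predicate _ fun h => ?_
      have h1 : (g • S).PosSemidef := Matrix.nonneg_iff_posSemidef.1 h
      have h2 := h1.diag_nonneg (i := i)
      have h3 := hS.diag_pos (i := i)
      simp only [Matrix.smul_apply, smul_eq_mul] at h2
      nlinarith

theorem inv_mul_sqrt_inv (hS : S.PosDef) : (CFC.sqrt S)⁻¹ * (CFC.sqrt S)⁻¹ = S⁻¹ := by
  rw [← Matrix.mul_inv_rev, sqrt_mul_sqrt hS]

end Sqrt

/-! ### The multivariate normal distribution -/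

theorem pi_gaussianReal_eq_withDensity {ι : Type*} [Fintype ι] :
    Measure.pi (fun _ : ι => gaussianReal 0 1) =
      (volume : Measure (ι → ℝ)).withDensity
        fun x => ENNReal.ofReal (∏ i, gaussianPDFReal 0 1 (x i)) := by
  refine Measure.pi_eq fun s hs => ?_
  have hint : ∀ i, Integrable ((s i).indicator (gaussianPDFReal 0 1)) :=
    fun i => (integrable_gaussianPDFReal 0 1).indicator (hs i)
  have hnn : ∀ i x, 0 ≤ (s i).indicator (gaussianPDFReal 0 1) x :=
    fun i x => indicator_nonneg (fun y _ => gaussianPDFReal_nonneg 0 1 y) x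
  have e : ∀ x : ι → ℝ, (univ.pi s).indicator
      (fun x => ENNReal.ofReal (∏ i, gaussianPDFReal 0 1 (x i))) x =
      ENNReal.ofReal (∏ i, (s i).indicator (gaussianPDFReal 0 1) (x i)) := by
    intro x
    by_cases hx : x ∈ univ.pi s
    · rw [indicator_of_mem hx]
      congr 1
      exact Finset.prod_congr rfl fun i _ => (indicator_of_mem (hx i (mem_univ i)) _).symm
    · rw [indicator_of_notMem hx]
      simp only [mem_univ_pi, not_forall] at hx
      obtain ⟨i, hi⟩ := hx
      rw [Finset.prod_eq_zero (Finset.mem_univ i) (indicator_of_notMem hi _), ENNReal.ofReal_zero]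
  rw [withDensity_apply _ (MeasurableSet.univ_pi hs), ← lintegral_indicator (.univ_pi hs)]
  simp_rw [e]
  rw [← ofReal_integral_eq_lintegral_ofReal (μ := (volume : Measure (ι → ℝ)))
    (by rw [volume_pi]; exact Integrable.fintype_prod hint) (Filter.Eventually.of_forall fun x => Finset.prod_nonneg fun i _ => hnn i _),
    integral_fintype_prod_volume_eq_prod, ENNReal.ofReal_prod_of_nonneg
    (fun i _ => integral_nonneg (hnn i))]
  refine Finset.prod_congr rfl fun i _ => ?_
  rw [integral_indicator (hs i), gaussianReal_apply_eq_integral 0 one_ne_zero]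

section Mvn

variable {p : ℕ} {S : Matrix (Fin p) (Fin p) ℝ}

theorem multivariateGaussian_eq_map_pi (m : EuclideanSpace ℝ (Fin p)) :
    multivariateGaussian m S = (Measure.pi (fun _ : Fin p => gaussianReal 0 1)).map
      (fun x => WithLp.toLp 2 (m.ofLp + CFC.sqrt S *ᵥ x)) := by
  rw [multivariateGaussian, ← map_pi_eq_stdGaussian, Measure.map_map (by fun_prop) (by fun_prop)]
  rfl

theorem normalPDF_nonneg (m : Fin p → ℝ) (S : Matrix (Fin p) (Fin p) ℝ) (y : Fin p → ℝ) :
    0 ≤ normalPDF m S y := by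
  unfold normalPDF; positivity

@[fun_prop]
theorem measurable_normalPDF (m : Fin p → ℝ) (S : Matrix (Fin p) (Fin p) ℝ) :
    Measurable (normalPDF m S) := by
  unfold normalPDF
  have : Continuous fun y : Fin p → ℝ => (y - m) ⬝ᵥ (S⁻¹ *ᵥ (y - m)) := by fun_prop
  have := this.measurable
  fun_prop

/-- Under the substitution `y = m + S^{1/2} x` the determinant is the Jacobian and the quadratic
form becomes `∑ xᵢ²`. -/
theorem det_mul_normalPDF (hS : S.PosDef) (m x : Fin p → ℝ) :
    (CFC.sqrt S).det * normalPDF m S (m + CFC.sqrt S *ᵥ x) = ∏ i, gaussianPDFReal 0 1 (x i) := by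
  have hd : (CFC.sqrt S).det * (CFC.sqrt S).det = S.det := by
    rw [← Matrix.det_mul, sqrt_mul_sqrt hS]
  have hpos := (posDef_sqrt hS).det_pos
  have hu := isUnit_det_of_posDef (posDef_sqrt hS)
  have hq : (CFC.sqrt S *ᵥ x) ⬝ᵥ (S⁻¹ *ᵥ (CFC.sqrt S *ᵥ x)) = ∑ i, x i ^ 2 := by
    rw [← inv_mul_sqrt_inv hS, Matrix.mulVec_mulVec, Matrix.mul_assoc, Matrix.nonsing_inv_mul _ hu,
      Matrix.mul_one, Matrix.dotProduct_mulVec, Matrix.vecMul_mulVec, ]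
    rw [transpose_sqrt, Matrix.mul_nonsing_inv _ hu, Matrix.vecMul_one, dotProduct]
    simp [sq]
  unfold normalPDF
  rw [add_sub_cancel_left, hq, ← hd, Real.sqrt_mul (by positivity), Real.sqrt_mul_self hpos.le]
  simp only [gaussianPDFReal, NNReal.coe_one, mul_one, sub_zero, Finset.prod_mul_distrib,
    Finset.prod_const, Finset.card_univ, Fintype.card_fin]
  rw [← Real.exp_sum, ← Finset.sum_div, Finset.sum_neg_distrib]
  have : √((2 * Real.pi) ^ p) = √(2 * Real.pi) ^ p := by
    rw [Real.sqrt_eq_iff_mul_self_eq (by positivity) (by positivity), ← mul_pow,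
      Real.mul_self_sqrt (by positivity)]
  rw [this, inv_pow]
  field_simp

theorem multivariateGaussian_eq_withDensity (hS : S.PosDef) (m : Fin p → ℝ) :
    multivariateGaussian (WithLp.toLp 2 m) S =
      volume.withDensity fun y => ENNReal.ofReal (normalPDF m S y.ofLp) := by
  have hdet := (posDef_sqrt hS).det_pos
  refine Measure.ext_of_lintegral _ fun g hg => ?_
  have hm : Measurable fun x : Fin p → ℝ => WithLp.toLp 2 (m + CFC.sqrt S *ᵥ x) := by
    have : Continuous fun x : Fin p → ℝ => m + CFC.sqrt S *ᵥ x := by fun_prop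
    exact (MeasurableEquiv.toLp 2 _).measurable.comp this.measurable
  have hpdf : Measurable fun y : EuclideanSpace ℝ (Fin p) =>
      ENNReal.ofReal (normalPDF m S y.ofLp) := by fun_prop
  rw [multivariateGaussian_eq_map_pi, lintegral_map hg hm, pi_gaussianReal_eq_withDensity,
    lintegral_withDensity_eq_lintegral_mul (g := fun x => g (WithLp.toLp 2 (m + CFC.sqrt S *ᵥ x)))
      _ (by fun_prop) (hg.comp hm),
    lintegral_withDensity_eq_lintegral_mul _ hpdf hg,
    ← (PiLp.volume_preserving_toLp (Fin p)).lintegral_comp (hpdf.mul hg)]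
  simp only [Pi.mul_apply, ← det_mul_normalPDF hS m]
  have hh : Measurable fun x : Fin p → ℝ =>
      ENNReal.ofReal (normalPDF m S x) * g (WithLp.toLp 2 x) := by fun_prop
  set h := fun x : Fin p → ℝ => ENNReal.ofReal (normalPDF m S x) * g (WithLp.toLp 2 x) with hdef
  have h1 : ∫⁻ x, h x = ENNReal.ofReal (CFC.sqrt S).det * ∫⁻ x, h (m + CFC.sqrt S *ᵥ x) := by
    have h2 := Real.map_matrix_volume_pi_eq_smul_volume_pi hdet.ne'
    have h3 : ∫⁻ x, h (m + x) ∂(Measure.map (Matrix.toLin' (CFC.sqrt S)) volume) =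
        ENNReal.ofReal |(CFC.sqrt S).det⁻¹| * ∫⁻ x, h x := by
      rw [h2, lintegral_smul_measure, lintegral_add_left_eq_self, smul_eq_mul]
    rw [lintegral_map (by fun_prop) (by fun_prop)] at h3
    simp only [Matrix.toLin'_apply] at h3
    rw [h3, ← mul_assoc, ← ENNReal.ofReal_mul hdet.le, abs_of_pos (inv_pos.2 hdet),
      mul_inv_cancel₀ hdet.ne', ENNReal.ofReal_one, one_mul]
  change _ = ∫⁻ x, h x
  rw [h1, ← lintegral_const_mul _ (by fun_prop)]
  simp only [ENNReal.ofReal_mul hdet.le, mul_assoc, hdef]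

/-- As the covariance varies only through a scalar, each measure is the image of one fixed product
Gaussian under a map that is jointly measurable in parameter and point. -/
theorem measurable_multivariateGaussian_smul {α : Type*} [MeasurableSpace α] (hS : S.PosDef)
    {f : α → EuclideanSpace ℝ (Fin p)} {g : α → ℝ} (hf : Measurable f) (hg : Measurable g) :
    Measurable fun w => multivariateGaussian (f w) (g w • S) := by
  refine Measure.measurable_of_measurable_coe _ fun s hs => ?_
  have hm : Measurable fun z : α × (Fin p → ℝ) =>
      WithLp.toLp 2 ((f z.1).ofLp + Real.sqrt (g z.1) • (CFC.sqrt S *ᵥ z.2)) := by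
    have : Measurable fun z : α × (Fin p → ℝ) => CFC.sqrt S *ᵥ z.2 := by
      have : Continuous fun x : Fin p → ℝ => CFC.sqrt S *ᵥ x := by fun_prop
      exact this.measurable.comp measurable_snd
    fun_prop
  have e : ∀ w, multivariateGaussian (f w) (g w • S) s =
      Measure.pi (fun _ : Fin p => gaussianReal 0 1) (Prod.mk w ⁻¹' ((fun z : α × (Fin p → ℝ) =>
      WithLp.toLp 2 ((f z.1).ofLp + Real.sqrt (g z.1) • (CFC.sqrt S *ᵥ z.2))) ⁻¹' s)) := by
    intro w
    rw [multivariateGaussian_eq_map_pi, sqrt_smul hS, Measure.map_apply _ hs]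
    · simp only [Matrix.smul_mulVec]; rfl
    · have h2 := hm.comp (measurable_prodMk_left (x := w))
      simp only [Matrix.smul_mulVec]
      exact h2
  simp_rw [e]
  exact measurable_measure_prodMk_left (hm hs)

theorem memLp_eval_multivariateGaussian (m : EuclideanSpace ℝ (Fin p)) (j : Fin p) :
    MemLp (fun x : EuclideanSpace ℝ (Fin p) => x j) 2 (multivariateGaussian m S) :=
  (IsGaussian.memLp_two_id (μ := multivariateGaussian m S)).continuousLinearMap_comp
    (EuclideanSpace.proj (𝕜 := ℝ) j)

theorem integral_eval_multivariateGaussian (m : EuclideanSpace ℝ (Fin p)) (j : Fin p) :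
    ∫ x, x j ∂(multivariateGaussian m S) = m j := by
  have h := (EuclideanSpace.proj (𝕜 := ℝ) j).integral_comp_comm
    ((IsGaussian.memLp_two_id (μ := multivariateGaussian m S)).integrable (by norm_num))
  simpa using h

theorem integral_eval_mul_eval_multivariateGaussian (hS : S.PosSemidef)
    (m : EuclideanSpace ℝ (Fin p)) (j k : Fin p) :
    ∫ x, x j * x k ∂(multivariateGaussian m S) = m j * m k + S j k := by
  have h := covariance_eval_multivariateGaussian (μ := m) hS j k
  rw [covariance_eq_sub (memLp_eval_multivariateGaussian m j)
    (memLp_eval_multivariateGaussian m k), integral_eval_multivariateGaussian,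
    integral_eval_multivariateGaussian] at h
  simp only [Pi.mul_apply] at h
  linarith

end Mvn

/-! ### The truncated normal distribution -/

theorem gaussianReal_Ioi (m c : ℝ) {v : ℝ} (hv : 0 < v) :
    gaussianReal m v.toNNReal (Ioi c) = ENNReal.ofReal (stdNormalCDF ((m - c) / √v)) := by
  have hs : 0 < √v := Real.sqrt_pos.2 hv
  -- The reflected parametrisation turns the upper tail into a lower tail, hence directly into a
  -- value of the cdf.
  have e : gaussianReal m v.toNNReal = (gaussianReal 0 1).map (fun x => m - √v * x) := by
    have : (fun x => m - √v * x) = (fun x => m - x) ∘ (fun x => √v * x) := rfl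
    rw [this, ← Measure.map_map (by fun_prop) (by fun_prop), gaussianReal_map_const_mul,
      gaussianReal_map_const_sub]
    congr 1
    · simp
    · ext; simp [Real.sq_sqrt hv.le, hv.le]
  have e2 : (fun x => m - √v * x) ⁻¹' Ioi c = Iio ((m - c) / √v) := by
    ext x
    simp only [mem_preimage, mem_Ioi, mem_Iio, lt_div_iff₀ hs]
    constructor <;> intro h <;> linarith
  have : NullSingletonClass (gaussianReal 0 1) := nullSingletonClass_gaussianReal one_ne_zero
  rw [e, Measure.map_apply (by fun_prop) measurableSet_Ioi, e2, stdNormalCDF, ofReal_cdf,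
    measure_congr Iio_ae_eq_Iic]

theorem stdNormalCDF_pos (x : ℝ) : 0 < stdNormalCDF x := by
  have h : gaussianReal 0 1 (Iic x) ≠ 0 := fun h => by
    have := gaussianReal_absolutelyContinuous' 0 one_ne_zero h
    simp at this
  rw [← ofReal_cdf] at h
  exact not_le.1 fun h' => h (ENNReal.ofReal_eq_zero.2 h')

theorem stdNormalCDF_le_one (x : ℝ) : stdNormalCDF x ≤ 1 := cdf_le_one _ _

theorem stdNormalCDF_zero : stdNormalCDF 0 = 1 / 2 := by
  have h1 := gaussianReal_Ioi 0 0 one_pos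
  rw [sub_zero, zero_div, Real.toNNReal_one] at h1
  have h2 : ENNReal.ofReal (stdNormalCDF 0) = gaussianReal 0 1 (Iic 0) := ofReal_cdf _ _
  have h3 := measure_add_measure_compl (μ := gaussianReal 0 1) (measurableSet_Iic (a := (0 : ℝ)))
  rw [compl_Iic, h1, ← h2, measure_univ, ← ENNReal.ofReal_add (stdNormalCDF_pos 0).le
    (stdNormalCDF_pos 0).le, ENNReal.ofReal_eq_one] at h3
  linarith

@[fun_prop]
theorem measurable_stdNormalCDF : Measurable stdNormalCDF :=
  (monotone_cdf (gaussianReal 0 1)).measurable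

theorem measurable_truncNormal {α : Type*} [MeasurableSpace α] {f g : α → ℝ} (hf : Measurable f)
    (hg : Measurable g) {I : Set ℝ} (hI : MeasurableSet I) :
    Measurable fun w => truncNormal (f w) (g w) I := by
  have h : Measurable fun w => gaussianReal (f w) (g w).toNNReal :=
    measurable_gaussianReal.comp (hf.prodMk hg.real_toNNReal)
  refine Measure.measurable_of_measurable_coe _ fun s hs => ?_
  simp only [truncNormal, cond_apply hI]
  exact ((Measure.measurable_coe hI).comp h).inv.mul
    ((Measure.measurable_coe (hI.inter hs)).comp h)

/-- Only an inequality: for `v ≤ 0` the Gaussian degenerates to a point mass, `I` may be null, and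
conditioning on it then yields the zero measure. -/
theorem truncNormal_univ_le (m v : ℝ) {I : Set ℝ} : truncNormal m v I univ ≤ 1 := by
  rw [truncNormal, ProbabilityTheory.cond, Measure.smul_apply, Measure.restrict_apply_univ,
    smul_eq_mul]
  exact ENNReal.inv_mul_le_one _

theorem isProbabilityMeasure_truncNormal_Ioi (m c : ℝ) {v : ℝ} (hv : 0 < v) :
    IsProbabilityMeasure (truncNormal m v (Ioi c)) := by
  refine cond_isProbabilityMeasure ?_
  rw [gaussianReal_Ioi m c hv]
  simpa using stdNormalCDF_pos _

theorem setLIntegral_Ioi_gaussianReal (m c : ℝ) {v : ℝ} (hv : 0 < v) (f : ℝ → ENNReal) :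
    ∫⁻ t in Ioi c, f t ∂(gaussianReal m v.toNNReal) =
      ENNReal.ofReal (stdNormalCDF ((m - c) / √v)) * ∫⁻ t, f t ∂(truncNormal m v (Ioi c)) := by
  rw [truncNormal, ProbabilityTheory.cond, lintegral_smul_measure, gaussianReal_Ioi m c hv,
    smul_eq_mul, ← mul_assoc, ENNReal.mul_inv_cancel, one_mul]
  · simpa using stdNormalCDF_pos _
  · exact ENNReal.ofReal_ne_top

theorem integral_truncNormal_Ioi (m c : ℝ) {v : ℝ} (hv : 0 < v) (f : ℝ → ℝ) :
    ∫ t, f t ∂(truncNormal m v (Ioi c)) = (stdNormalCDF ((m - c) / √v))⁻¹ *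
      ∫ t in Ioi c, gaussianPDFReal m v.toNNReal t * f t := by
  have hv' : v.toNNReal ≠ 0 := by simpa using hv
  rw [truncNormal, ProbabilityTheory.cond, integral_smul_measure, gaussianReal_Ioi m c hv,
    ENNReal.toReal_inv, ENNReal.toReal_ofReal (stdNormalCDF_pos _).le, smul_eq_mul,
    ← integral_indicator measurableSet_Ioi, integral_gaussianReal_eq_integral_smul hv',
    ← integral_indicator measurableSet_Ioi]
  congr 2
  ext t
  by_cases ht : t ∈ Ioi c <;> simp [ht]

theorem integrable_truncNormal_Ioi {m c v : ℝ} (hv : 0 < v) {f : ℝ → ℝ}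
    (hf : Integrable f (gaussianReal m v.toNNReal)) :
    Integrable f (truncNormal m v (Ioi c)) := by
  refine Integrable.smul_measure hf.restrict ?_
  rw [gaussianReal_Ioi m c hv, ENNReal.inv_ne_top]
  simpa using stdNormalCDF_pos _

theorem integrable_pow_gaussianReal (m : ℝ) (v : NNReal) (k : ℕ) :
    Integrable (fun t : ℝ => t ^ k) (gaussianReal m v) :=
  (integrable_norm_iff (by fun_prop)).1 (by
    simpa [norm_pow] using (memLp_id_gaussianReal (μ := m) (v := v) (k : NNReal)).integrable_norm_pow')

theorem integrable_gaussianPDFReal_mul_pow (m : ℝ) {v : ℝ} (hv : 0 < v) (k : ℕ) :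
    Integrable (fun t : ℝ => gaussianPDFReal m v.toNNReal t * t ^ k) := by
  have hv' : v.toNNReal ≠ 0 := by simpa using hv
  have h := integrable_pow_gaussianReal m v.toNNReal k
  rw [gaussianReal_of_var_ne_zero _ hv', integrable_withDensity_iff_integrable_smul'
    (measurable_gaussianPDF _ _) (Filter.Eventually.of_forall fun x => gaussianPDF_lt_top)] at h
  simpa [toReal_gaussianPDF] using h

theorem hasDerivAt_gaussianPDFReal (m : ℝ) {v : ℝ} (hv : 0 < v) (x : ℝ) :
    HasDerivAt (gaussianPDFReal m v.toNNReal)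
      (-(x - m) / v * gaussianPDFReal m v.toNNReal x) x := by
  have h : gaussianPDFReal m v.toNNReal =
      fun x => (√(2 * Real.pi * v))⁻¹ * Real.exp (-(x - m) ^ 2 / (2 * v)) := by
    rw [gaussianPDFReal_def]; simp [hv.le]
  rw [h]
  have h1 : HasDerivAt (fun x : ℝ => -(x - m) ^ 2 / (2 * v)) (-(x - m) / v) x := by
    have := ((((hasDerivAt_id x).sub_const m).pow 2).neg).div_const (2 * v)
    convert! this using 1
    simp; field_simp; ring
  convert! (h1.exp.const_mul (√(2 * Real.pi * v))⁻¹) using 1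
  ring

/-- The integrand is the derivative of `-v φ`. The limit at infinity is zero because both the
primitive and its derivative are integrable. -/
theorem integral_Ioi_sub_mul_gaussianPDFReal (m c : ℝ) {v : ℝ} (hv : 0 < v) :
    ∫ t in Ioi c, (t - m) * gaussianPDFReal m v.toNNReal t = v * gaussianPDFReal m v.toNNReal c := by
  have i0 := integrable_gaussianPDFReal_mul_pow m hv 0
  have i1 := integrable_gaussianPDFReal_mul_pow m hv 1
  simp only [pow_zero, mul_one, pow_one] at i0 i1
  have hd : ∀ x, HasDerivAt (fun t => -v * gaussianPDFReal m v.toNNReal t)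
      ((x - m) * gaussianPDFReal m v.toNNReal x) x := by
    intro x
    convert! (hasDerivAt_gaussianPDFReal m hv x).const_mul (-v) using 1
    field_simp
  have hi' : Integrable fun t => (t - m) * gaussianPDFReal m v.toNNReal t := by
    convert! i1.sub (i0.const_mul m) using 1
    ext t; simp; ring
  have ht := tendsto_zero_of_hasDerivAt_of_integrableOn_Ioi (a := c) (fun x _ => hd x)
    hi'.integrableOn (i0.const_mul (-v)).integrableOn
  rw [integral_Ioi_of_hasDerivAt_of_tendsto' (fun x _ => hd x) hi'.integrableOn ht]
  ring

/-- Subtracting `m² + v` makes the integrand exact, with primitive `-v (t + m) φ`; this yields the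
second moment without a separate first moment. -/
theorem integral_Ioi_sq_sub_mul_gaussianPDFReal (m c : ℝ) {v : ℝ} (hv : 0 < v) :
    ∫ t in Ioi c, (t ^ 2 - m ^ 2 - v) * gaussianPDFReal m v.toNNReal t =
      v * (c + m) * gaussianPDFReal m v.toNNReal c := by
  have i0 := integrable_gaussianPDFReal_mul_pow m hv 0
  have i1 := integrable_gaussianPDFReal_mul_pow m hv 1
  have i2 := integrable_gaussianPDFReal_mul_pow m hv 2
  simp only [pow_zero, mul_one, pow_one] at i0 i1
  have hd : ∀ x, HasDerivAt (fun t => -v * ((t + m) * gaussianPDFReal m v.toNNReal t))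
      ((x ^ 2 - m ^ 2 - v) * gaussianPDFReal m v.toNNReal x) x := by
    intro x
    convert! (((hasDerivAt_id x).add_const m).mul (hasDerivAt_gaussianPDFReal m hv x)).const_mul
      (-v) using 1
    simp; field_simp; ring
  have hi' : Integrable fun t => (t ^ 2 - m ^ 2 - v) * gaussianPDFReal m v.toNNReal t := by
    convert! i2.sub (i0.const_mul (m ^ 2 + v)) using 1
    ext t; simp; ring
  have hi : Integrable fun t => -v * ((t + m) * gaussianPDFReal m v.toNNReal t) := by
    convert! (i1.add (i0.const_mul m)).const_mul (-v) using 1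
    ext t; simp only [Pi.add_apply]; ring
  have ht := tendsto_zero_of_hasDerivAt_of_integrableOn_Ioi (a := c) (fun x _ => hd x)
    hi'.integrableOn hi.integrableOn
  rw [integral_Ioi_of_hasDerivAt_of_tendsto' (fun x _ => hd x) hi'.integrableOn ht]
  ring

theorem gaussianPDFReal_eq_std (m c : ℝ) {v : ℝ} (hv : 0 < v) :
    √v * gaussianPDFReal m v.toNNReal c = gaussianPDFReal 0 1 ((m - c) / √v) := by
  have hs : 0 < √v := Real.sqrt_pos.2 hv
  simp only [gaussianPDFReal, Real.coe_toNNReal _ hv.le, NNReal.coe_one, mul_one, sub_zero, div_pow,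
    Real.sq_sqrt hv.le]
  rw [Real.sqrt_mul (by positivity)]
  have : -(c - m) ^ 2 / (2 * v) = -((m - c) ^ 2 / v) / 2 := by field_simp; ring
  rw [this]
  field_simp

theorem integral_id_truncNormal_Ioi (m c : ℝ) {v : ℝ} (hv : 0 < v) :
    ∫ t, t ∂(truncNormal m v (Ioi c)) = m + √v * WPhi ((m - c) / √v) := by
  have := isProbabilityMeasure_truncNormal_Ioi m c hv
  have hi : Integrable (fun t => t) (truncNormal m v (Ioi c)) :=
    integrable_truncNormal_Ioi hv (by simpa using integrable_pow_gaussianReal m v.toNNReal 1)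
  have h := integral_truncNormal_Ioi m c hv (fun t => t - m)
  rw [integral_sub hi (integrable_const m), integral_const] at h
  simp only [probReal_univ, smul_eq_mul, one_mul, mul_comm (gaussianPDFReal _ _ _)] at h
  rw [integral_Ioi_sub_mul_gaussianPDFReal m c hv] at h
  rw [WPhi, ← gaussianPDFReal_eq_std m c hv]
  have hs := Real.mul_self_sqrt hv.le
  rw [← sub_eq_iff_eq_add', h, ← mul_div_assoc, ← mul_assoc √v, hs]
  ring

theorem integral_sq_truncNormal_Ioi (m c : ℝ) {v : ℝ} (hv : 0 < v) :
    ∫ t, t ^ 2 ∂(truncNormal m v (Ioi c)) =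
      v + m ^ 2 + √v * (c + m) * WPhi ((m - c) / √v) := by
  have := isProbabilityMeasure_truncNormal_Ioi m c hv
  have hi : Integrable (fun t => t ^ 2) (truncNormal m v (Ioi c)) :=
    integrable_truncNormal_Ioi hv (integrable_pow_gaussianReal m v.toNNReal 2)
  have h := integral_truncNormal_Ioi m c hv (fun t => t ^ 2 - m ^ 2 - v)
  rw [integral_sub (f := fun t => t ^ 2 - m ^ 2) (hi.sub (integrable_const _)) (integrable_const _),
    integral_sub hi (integrable_const _), integral_const, integral_const] at h
  simp only [probReal_univ, smul_eq_mul, one_mul, mul_comm (gaussianPDFReal _ _ _)] at h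
  rw [integral_Ioi_sq_sub_mul_gaussianPDFReal m c hv] at h
  rw [WPhi, ← gaussianPDFReal_eq_std m c hv]
  have hs := Real.mul_self_sqrt hv.le
  have e : √v * (c + m) * (√v * gaussianPDFReal m v.toNNReal c / stdNormalCDF ((m - c) / √v)) =
    (stdNormalCDF ((m - c) / √v))⁻¹ * (√v * √v * (c + m) * gaussianPDFReal m v.toNNReal c) := by
    ring
  rw [e, hs, ← h]
  ring

/-! ### Linear algebra of the mixed model -/

theorem mulVec_vecMulVec_self {p : ℕ} (u v w : Fin p → ℝ) :
    Matrix.vecMulVec u v *ᵥ w = (v ⬝ᵥ w) • u := by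
  rw [Matrix.vecMulVec_mulVec]
  ext i; simp [mul_comm]

theorem dotProduct_mulVec_symm {p : ℕ} {S : Matrix (Fin p) (Fin p) ℝ} (hS : Sᵀ = S)
    (x y : Fin p → ℝ) : x ⬝ᵥ (S *ᵥ y) = (S *ᵥ x) ⬝ᵥ y := by
  rw [Matrix.dotProduct_mulVec, ← Matrix.mulVec_transpose, hS]

namespace SMSNLMM

variable {n l q : ℕ} (θ : SMSNLMM n l q)

theorem Sig_posDef : θ.Sig.PosDef := θ.R_posDef.smul θ.sigmaSq_pos

theorem one_add_lam_pos : 0 < 1 + θ.lam ⬝ᵥ θ.lam := by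
  have : 0 ≤ θ.lam ⬝ᵥ θ.lam := dotProduct_self_star_nonneg θ.lam
  linarith

theorem delta_dotProduct_delta : θ.delta ⬝ᵥ θ.delta < 1 := by
  have h := θ.one_add_lam_pos
  rw [delta, smul_dotProduct, dotProduct_smul, smul_smul, ← mul_inv,
    Real.mul_self_sqrt h.le, smul_eq_mul, inv_mul_lt_iff₀ h]
  linarith

/-- `Γ = D^{1/2} (I - δδᵀ) D^{1/2}`, and `I - δδᵀ` is positive definite by Cauchy–Schwarz since `δᵀδ
< 1`. -/
theorem Gam_posDef : θ.Gam.PosDef := by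
  have hD := θ.D_posDef
  refine Matrix.PosDef.of_dotProduct_mulVec_pos ?_ fun x hx => ?_
  · have := hD.transpose_eq
    simp only [Matrix.IsHermitian, Matrix.conjTranspose_eq_transpose_of_trivial, Gam,
      Matrix.transpose_sub, this, Matrix.transpose_vecMulVec]
  · have hy : CFC.sqrt θ.D *ᵥ x ≠ 0 := fun h => hx <| by
      have h2 := congrArg (fun z => (CFC.sqrt θ.D)⁻¹ *ᵥ z) h
      simpa [Matrix.mulVec_mulVec,
        Matrix.nonsing_inv_mul _ (isUnit_det_of_posDef (posDef_sqrt hD))] using h2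
    set y := CFC.sqrt θ.D *ᵥ x with hydef
    have e1 : x ⬝ᵥ (θ.D *ᵥ x) = y ⬝ᵥ y := by
      rw [hydef, ← dotProduct_mulVec_symm (transpose_sqrt _), Matrix.mulVec_mulVec,
        sqrt_mul_sqrt hD]
    have e2 : θ.Delta ⬝ᵥ x = θ.delta ⬝ᵥ y := by
      rw [hydef, dotProduct_mulVec_symm (transpose_sqrt _), Delta]
    have hpos : 0 < y ⬝ᵥ y := Matrix.dotProduct_self_star_pos_iff.2 hy
    have hcs : (θ.delta ⬝ᵥ y) ^ 2 ≤ (θ.delta ⬝ᵥ θ.delta) * (y ⬝ᵥ y) := by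
      simp only [dotProduct, ← sq]
      exact Finset.sum_mul_sq_le_sq_mul_sq _ _ _
    have hlt := θ.delta_dotProduct_delta
    simp only [star_trivial]
    rw [Gam, Matrix.sub_mulVec, dotProduct_sub, e1, mulVec_vecMulVec_self, dotProduct_smul,
      dotProduct_comm x, e2, smul_eq_mul]
    nlinarith

theorem Omega_posDef : θ.Omega.PosDef :=
  θ.Sig_posDef.add_posSemidef (by
    simpa using θ.Gam_posDef.posSemidef.mul_mul_conjTranspose_same θ.Z)

theorem Psi_posDef : θ.Psi.PosDef :=
  θ.Sig_posDef.add_posSemidef (by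
    simpa using θ.D_posDef.posSemidef.mul_mul_conjTranspose_same θ.Z)

theorem B_inv_posDef : (θ.Gam⁻¹ + θ.Zᵀ * θ.Sig⁻¹ * θ.Z).PosDef :=
  θ.Gam_posDef.inv.add_posSemidef (by
    simpa using θ.Sig_posDef.inv.posSemidef.conjTranspose_mul_mul_same θ.Z)

theorem B_posDef : θ.B.PosDef := θ.B_inv_posDef.inv

/-- The gain matrix of the regression of `b` on `Y`. -/
def gain : Matrix (Fin q) (Fin n) ℝ := θ.B * θ.Zᵀ * θ.Sig⁻¹

/-- The push-through identity: after multiplication by `B⁻¹` both sides are `Zᵀ + ZᵀΣ⁻¹ZΓZᵀ`. It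
identifies the gain with the regression matrix `ΓZᵀΩ⁻¹`. -/
theorem gain_mul_Omega : θ.gain * θ.Omega = θ.Gam * θ.Zᵀ := by
  have hS := isUnit_det_of_posDef θ.Sig_posDef
  have hG := isUnit_det_of_posDef θ.Gam_posDef
  have hB := isUnit_det_of_posDef θ.B_inv_posDef
  have e : θ.Zᵀ * θ.Sig⁻¹ * θ.Omega = (θ.Gam⁻¹ + θ.Zᵀ * θ.Sig⁻¹ * θ.Z) * (θ.Gam * θ.Zᵀ) := by
    rw [Omega, Matrix.mul_add, Matrix.add_mul, Matrix.mul_assoc θ.Zᵀ θ.Sig⁻¹ θ.Sig,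
      Matrix.nonsing_inv_mul _ hS, Matrix.mul_one, ← Matrix.mul_assoc θ.Gam⁻¹,
      Matrix.nonsing_inv_mul _ hG, Matrix.one_mul]
    simp only [Matrix.mul_assoc]
  rw [gain, Matrix.mul_assoc θ.B, Matrix.mul_assoc θ.B, e, ← Matrix.mul_assoc, B,
    Matrix.nonsing_inv_mul _ hB, Matrix.one_mul]

/-- Expand `B B⁻¹ Γ = Γ`. The prior covariance splits into a residual and an explained part. -/
theorem B_add_gain : θ.B + θ.gain * θ.Z * θ.Gam = θ.Gam := by
  have hG := isUnit_det_of_posDef θ.Gam_posDef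
  have hB := isUnit_det_of_posDef θ.B_inv_posDef
  have e : θ.B * ((θ.Gam⁻¹ + θ.Zᵀ * θ.Sig⁻¹ * θ.Z) * θ.Gam) = θ.Gam := by
    rw [← Matrix.mul_assoc, B, Matrix.nonsing_inv_mul _ hB, Matrix.one_mul]
  rw [Matrix.add_mul, Matrix.nonsing_inv_mul _ hG, Matrix.mul_add, Matrix.mul_one] at e
  rw [gain]
  simpa only [Matrix.mul_assoc] using e

/-- `Z Δ`. -/
def ZDelta : Fin n → ℝ := θ.Z *ᵥ θ.Delta

theorem Psi_eq : θ.Psi = θ.Omega + Matrix.vecMulVec θ.ZDelta θ.ZDelta := by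
  rw [Omega, Psi, Gam, Matrix.mul_sub, Matrix.sub_mul, Matrix.mul_vecMulVec, Matrix.vecMulVec_mul,
    Matrix.vecMul_transpose, ZDelta]
  abel

theorem Psi_mulVec (x : Fin n → ℝ) :
    θ.Psi *ᵥ x = θ.Omega *ᵥ x + (θ.ZDelta ⬝ᵥ x) • θ.ZDelta := by
  rw [Psi_eq, Matrix.add_mulVec, mulVec_vecMulVec_self]

theorem one_add_Omega_pos : 0 < 1 + θ.ZDelta ⬝ᵥ (θ.Omega⁻¹ *ᵥ θ.ZDelta) := by
  have := θ.Omega_posDef.inv.posSemidef.dotProduct_mulVec_nonneg θ.ZDelta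
  simp only [star_trivial] at this
  linarith

theorem M_pos : 0 < θ.M := Real.rpow_pos_of_pos θ.one_add_Omega_pos _

theorem M_sq : θ.M ^ 2 = (1 + θ.ZDelta ⬝ᵥ (θ.Omega⁻¹ *ᵥ θ.ZDelta))⁻¹ := by
  rw [M, ← ZDelta, ← Real.rpow_natCast, ← Real.rpow_mul θ.one_add_Omega_pos.le,
    ← Real.rpow_neg_one]
  norm_num

/-- Sherman–Morrison for the rank-one update `Ψ = Ω + (ZΔ)(ZΔ)ᵀ`, checked by applying `Ψ`. -/
theorem Omega_inv_ZDelta :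
    θ.M ^ 2 • (θ.Omega⁻¹ *ᵥ θ.ZDelta) = θ.Psi⁻¹ *ᵥ θ.ZDelta := by
  have hO := isUnit_det_of_posDef θ.Omega_posDef
  have hP := isUnit_det_of_posDef θ.Psi_posDef
  have h := θ.one_add_Omega_pos
  have e : θ.Psi *ᵥ (θ.M ^ 2 • (θ.Omega⁻¹ *ᵥ θ.ZDelta)) = θ.ZDelta := by
    rw [Matrix.mulVec_smul, Psi_mulVec, Matrix.mulVec_mulVec, Matrix.mul_nonsing_inv _ hO,
      Matrix.one_mulVec, M_sq]
    rw [show ∀ (a : ℝ) (x : Fin n → ℝ), x + a • x = (1 + a) • x from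
      fun a x => by rw [add_smul, one_smul], smul_smul, inv_mul_cancel₀ h.ne', one_smul]
  nth_rw 2 [← e]
  rw [Matrix.mulVec_mulVec, Matrix.nonsing_inv_mul _ hP, Matrix.one_mulVec]

theorem mu_eq (y : Fin n → ℝ) : θ.mu y = (θ.Psi⁻¹ *ᵥ θ.ZDelta) ⬝ᵥ (y - θ.loc) := by
  rw [← Omega_inv_ZDelta, smul_dotProduct, ← dotProduct_mulVec_symm θ.Omega_posDef.inv.transpose_eq]
  rfl

theorem M_sq_eq : θ.M ^ 2 + θ.ZDelta ⬝ᵥ (θ.Psi⁻¹ *ᵥ θ.ZDelta) = 1 := by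
  rw [← Omega_inv_ZDelta, dotProduct_smul, smul_eq_mul, M_sq]
  have := θ.one_add_Omega_pos
  field_simp

theorem D_mulVec_zeta : θ.D *ᵥ θ.zeta = √(1 + θ.lam ⬝ᵥ θ.lam) • θ.Delta := by
  have hu := isUnit_det_of_posDef (posDef_sqrt θ.D_posDef)
  have h := θ.one_add_lam_pos
  rw [zeta, Delta, delta, Matrix.mulVec_smul, smul_smul, mul_inv_cancel₀ (Real.sqrt_pos.2 h).ne',
    one_smul, Matrix.mulVec_mulVec]
  nth_rw 1 [← sqrt_mul_sqrt θ.D_posDef]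
  rw [Matrix.mul_assoc, Matrix.mul_nonsing_inv _ hu, Matrix.mul_one]

theorem zeta_D_zeta : θ.zeta ⬝ᵥ (θ.D *ᵥ θ.zeta) = θ.lam ⬝ᵥ θ.lam := by
  have hu := isUnit_det_of_posDef (posDef_sqrt θ.D_posDef)
  nth_rw 1 [← sqrt_mul_sqrt θ.D_posDef]
  rw [← Matrix.mulVec_mulVec, dotProduct_mulVec_symm (transpose_sqrt _), zeta,
    Matrix.mulVec_mulVec, Matrix.mul_nonsing_inv _ hu, Matrix.one_mulVec]

/-- Woodbury's identity, which brings in `Ψ⁻¹`, the inverse that also governs `μ` and `M`. -/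
theorem Lam_eq : θ.Lam = θ.D - θ.D * θ.Zᵀ * θ.Psi⁻¹ * θ.Z * θ.D := by
  have hD := isUnit_det_of_posDef θ.D_posDef
  have hS := isUnit_det_of_posDef θ.Sig_posDef
  rw [Lam, Matrix.add_mul_mul_inv_eq_sub _ _ _ _ θ.D_posDef.inv.isUnit θ.Sig_posDef.inv.isUnit]
  · rw [Matrix.nonsing_inv_nonsing_inv _ hD, Matrix.nonsing_inv_nonsing_inv _ hS, Psi]
  · rw [Matrix.nonsing_inv_nonsing_inv _ hD, Matrix.nonsing_inv_nonsing_inv _ hS]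
    exact θ.Psi_posDef.isUnit

/-- Since `Dζ = √(1 + λᵀλ) Δ`, the Woodbury correction is `(1 + λᵀλ)(ZΔ)ᵀΨ⁻¹ZΔ`, which is `(1 +
λᵀλ)(1 - M²)`. The factor `1 + λᵀλ` cancels in `λ̄`. -/
theorem one_add_zeta_Lam_zeta :
    1 + θ.zeta ⬝ᵥ (θ.Lam *ᵥ θ.zeta) = (1 + θ.lam ⬝ᵥ θ.lam) * θ.M ^ 2 := by
  have h := θ.one_add_lam_pos
  have hs := Real.mul_self_sqrt h.le
  have e : θ.zeta ⬝ᵥ ((θ.D * θ.Zᵀ * θ.Psi⁻¹ * θ.Z * θ.D) *ᵥ θ.zeta) =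
      (1 + θ.lam ⬝ᵥ θ.lam) * (θ.ZDelta ⬝ᵥ (θ.Psi⁻¹ *ᵥ θ.ZDelta)) := by
    simp only [Matrix.mul_assoc]
    rw [← Matrix.mulVec_mulVec, dotProduct_mulVec_symm θ.D_posDef.transpose_eq,
      ← Matrix.mulVec_mulVec, Matrix.dotProduct_mulVec, Matrix.vecMul_transpose,
      ← Matrix.mulVec_mulVec, ← Matrix.mulVec_mulVec, D_mulVec_zeta, Matrix.mulVec_smul,
      Matrix.mulVec_smul, smul_dotProduct, dotProduct_smul, smul_smul, hs, smul_eq_mul]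
    rfl
  have hM := θ.M_sq_eq
  rw [Lam_eq, Matrix.sub_mulVec, dotProduct_sub, e, zeta_D_zeta]
  linear_combination -(1 + θ.lam ⬝ᵥ θ.lam) * hM

theorem A_eq (y : Fin n → ℝ) :
    θ.A y = θ.lamBar ⬝ᵥ ((CFC.sqrt θ.Psi)⁻¹ *ᵥ (y - θ.loc)) := by
  have h := θ.one_add_lam_pos
  have hM := θ.M_pos
  have hsym : ((CFC.sqrt θ.Psi)⁻¹)ᵀ = (CFC.sqrt θ.Psi)⁻¹ := by
    rw [Matrix.transpose_nonsing_inv, transpose_sqrt]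
  rw [A, mu_eq, lamBar, one_add_zeta_Lam_zeta, D_mulVec_zeta, smul_dotProduct,
    dotProduct_mulVec_symm hsym, Matrix.mulVec_mulVec, inv_mul_sqrt_inv θ.Psi_posDef,
    Matrix.mulVec_smul, Matrix.mulVec_smul, smul_dotProduct, smul_smul,
    Real.sqrt_mul h.le, Real.sqrt_sq hM.le, mul_inv, mul_comm (√_)⁻¹, mul_assoc,
    inv_mul_cancel₀ (Real.sqrt_pos.2 h).ne', mul_one, smul_eq_mul, div_eq_inv_mul]
  rfl

end SMSNLMM

/-! ### Bayes' rule for linear Gaussian models -/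

section Bayes

open scoped RealInnerProductSpace

variable {n p : ℕ}

theorem inner_toLp_left (x : Fin p → ℝ) (y : EuclideanSpace ℝ (Fin p)) :
    ⟪WithLp.toLp 2 x, y⟫ = x ⬝ᵥ y.ofLp := by
  simp [EuclideanSpace.inner_eq_star_dotProduct, dotProduct_comm]

theorem inner_toLp_right (x : EuclideanSpace ℝ (Fin p)) (y : Fin p → ℝ) :
    ⟪x, WithLp.toLp 2 y⟫ = x.ofLp ⬝ᵥ y := by
  simp [EuclideanSpace.inner_eq_star_dotProduct, dotProduct_comm]

/-- `K` is the regression matrix of `b` on `y` and `B` the residual covariance. Both are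
characterised by equations free of inverses, which survive the common scaling by `u⁻¹`. -/
theorem lintegral_gaussian_linear_swap {S B : Matrix (Fin p) (Fin p) ℝ}
    {Sg W : Matrix (Fin n) (Fin n) ℝ} {Z : Matrix (Fin n) (Fin p) ℝ} {K : Matrix (Fin p) (Fin n) ℝ}
    (hS : S.PosDef) (hB : B.PosDef) (hSg : Sg.PosDef) (hW : W.PosDef)
    (hWeq : W = Sg + Z * S * Zᵀ) (hK : K * W = S * Zᵀ) (hBK : B + K * Z * S = S)
    (a : Fin n → ℝ) (m : Fin p → ℝ)
    {g : EuclideanSpace ℝ (Fin p) × EuclideanSpace ℝ (Fin n) → ENNReal} (hg : Measurable g) :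
    ∫⁻ b, ∫⁻ y, g (b, y) ∂(multivariateGaussian (WithLp.toLp 2 (a + Z *ᵥ b.ofLp)) Sg)
        ∂(multivariateGaussian (WithLp.toLp 2 m) S) =
      ∫⁻ y, ∫⁻ b, g (b, y)
          ∂(multivariateGaussian (WithLp.toLp 2 (m + K *ᵥ (y.ofLp - (a + Z *ᵥ m)))) B)
        ∂(multivariateGaussian (WithLp.toLp 2 (a + Z *ᵥ m)) W) := by
  have m1 : Measurable fun b : EuclideanSpace ℝ (Fin p) =>
      multivariateGaussian (WithLp.toLp 2 (a + Z *ᵥ b.ofLp)) Sg := by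
    have h : Continuous fun b : EuclideanSpace ℝ (Fin p) => WithLp.toLp 2 (a + Z *ᵥ b.ofLp) := by
      fun_prop
    simpa using measurable_multivariateGaussian_smul hSg h.measurable (measurable_const (a := 1))
  have m2 : Measurable fun y : EuclideanSpace ℝ (Fin n) =>
      multivariateGaussian (WithLp.toLp 2 (m + K *ᵥ (y.ofLp - (a + Z *ᵥ m)))) B := by
    have h : Continuous fun y : EuclideanSpace ℝ (Fin n) =>
        WithLp.toLp 2 (m + K *ᵥ (y.ofLp - (a + Z *ᵥ m))) := by fun_prop
    simpa using measurable_multivariateGaussian_smul hB h.measurable (measurable_const (a := 1))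
  let κ : Kernel (EuclideanSpace ℝ (Fin p)) (EuclideanSpace ℝ (Fin n)) := ⟨_, m1⟩
  let η : Kernel (EuclideanSpace ℝ (Fin n)) (EuclideanSpace ℝ (Fin p)) := ⟨_, m2⟩
  have : IsMarkovKernel κ := ⟨fun b => by
    change IsProbabilityMeasure (multivariateGaussian _ _); infer_instance⟩
  have : IsMarkovKernel η := ⟨fun b => by
    change IsProbabilityMeasure (multivariateGaussian _ _); infer_instance⟩
  have hswap : multivariateGaussian (WithLp.toLp 2 m) S ⊗ₘ κ =
      (multivariateGaussian (WithLp.toLp 2 (a + Z *ᵥ m)) W ⊗ₘ η).map Prod.swap := by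
    refine gaussian_compProd_swap
      (m := WithLp.toLp 2 m) (a' := WithLp.toLp 2 (m - K *ᵥ (a + Z *ᵥ m)))
      (m' := WithLp.toLp 2 (a + Z *ᵥ m)) (a := WithLp.toLp 2 a)
      (L := fun b => WithLp.toLp 2 (Z *ᵥ b.ofLp)) (L' := fun y => WithLp.toLp 2 (K *ᵥ y.ofLp))
      (Ls := fun y => WithLp.toLp 2 (Zᵀ *ᵥ y.ofLp)) (Ls' := fun b => WithLp.toLp 2 (Kᵀ *ᵥ b.ofLp))
      (R := fun x => x.ofLp ⬝ᵥ (S *ᵥ x.ofLp)) (Q' := fun x => x.ofLp ⬝ᵥ (B *ᵥ x.ofLp))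
      (R' := fun x => x.ofLp ⬝ᵥ (W *ᵥ x.ofLp)) (Q := fun x => x.ofLp ⬝ᵥ (Sg *ᵥ x.ofLp))
      ?_ ?_ ?_ ?_ ?_ ?_ ?_ ?_ ?_
    · intro e w
      rw [inner_toLp_left, inner_toLp_right, Matrix.mulVec_transpose,
        dotProduct_comm _ (_ ᵥ* _), ← Matrix.dotProduct_mulVec, dotProduct_comm]
    · intro e w
      rw [inner_toLp_left, inner_toLp_right, Matrix.mulVec_transpose,
        dotProduct_comm _ (_ ᵥ* _), ← Matrix.dotProduct_mulVec, dotProduct_comm]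
    · intro x
      rw [charFun_multivariateGaussian hS.posSemidef, real_inner_comm]
    · intro e w
      change charFun (multivariateGaussian _ _) w = _
      rw [charFun_multivariateGaussian hSg.posSemidef, real_inner_comm]; rfl
    · intro w
      rw [charFun_multivariateGaussian hW.posSemidef, real_inner_comm]
    · intro f x
      change charFun (multivariateGaussian _ _) x = _
      rw [charFun_multivariateGaussian hB.posSemidef, real_inner_comm, ← WithLp.toLp_add,
        Matrix.mulVec_sub]
      congr 5
      abel_nf
    · rw [← WithLp.toLp_add]; congr 1; abel
    · rw [← WithLp.toLp_add]
    -- Both sides are the quadratic form of the joint covariance of `(b, y)`. Every mixed term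
    -- reduces to `xᵀSZᵀw`, and `hBK` accounts for the terms in `x` alone.
    · intro x w
      simp only [WithLp.ofLp_add]
      generalize x.ofLp = x
      generalize w.ofLp = w
      have hSt := hS.transpose_eq
      have hWt := hW.transpose_eq
      have e0 : (Kᵀ *ᵥ x) ⬝ᵥ (W *ᵥ w) = x ⬝ᵥ ((S * Zᵀ) *ᵥ w) := by
        rw [← hK, ← Matrix.mulVec_mulVec, Matrix.mulVec_transpose, Matrix.dotProduct_mulVec x]
      have e1 : w ⬝ᵥ (W *ᵥ (Kᵀ *ᵥ x)) = x ⬝ᵥ ((S * Zᵀ) *ᵥ w) := by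
        rw [dotProduct_mulVec_symm hWt, dotProduct_comm, e0]
      have e2 : (Kᵀ *ᵥ x) ⬝ᵥ (W *ᵥ (Kᵀ *ᵥ x)) = x ⬝ᵥ ((K * Z * S) *ᵥ x) := by
        have h1 : S * Zᵀ * Kᵀ = (K * Z * S)ᵀ := by
          simp only [Matrix.transpose_mul, hSt, Matrix.mul_assoc]
        have h2 : (Kᵀ *ᵥ x) ⬝ᵥ (W *ᵥ (Kᵀ *ᵥ x)) = x ⬝ᵥ ((S * Zᵀ * Kᵀ) *ᵥ x) := by
          rw [← hK, ← Matrix.mulVec_mulVec, ← Matrix.mulVec_mulVec, Matrix.dotProduct_mulVec x,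
            ← Matrix.mulVec_transpose]
        rw [h2, h1, Matrix.mulVec_transpose, dotProduct_comm, ← Matrix.dotProduct_mulVec]
      have f1 : w ⬝ᵥ (W *ᵥ w) = w ⬝ᵥ (Sg *ᵥ w) + (Zᵀ *ᵥ w) ⬝ᵥ (S *ᵥ (Zᵀ *ᵥ w)) := by
        rw [hWeq, Matrix.add_mulVec, dotProduct_add, Matrix.mul_assoc, ← Matrix.mulVec_mulVec,
          ← Matrix.mulVec_mulVec, Matrix.dotProduct_mulVec w Z, Matrix.mulVec_transpose]
      have f2 : x ⬝ᵥ (S *ᵥ x) = x ⬝ᵥ (B *ᵥ x) + x ⬝ᵥ ((K * Z * S) *ᵥ x) := by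
        rw [← dotProduct_add, ← Matrix.add_mulVec, hBK]
      have f3 : (Zᵀ *ᵥ w) ⬝ᵥ (S *ᵥ x) = x ⬝ᵥ ((S * Zᵀ) *ᵥ w) := by
        rw [dotProduct_mulVec_symm hSt, dotProduct_comm, Matrix.mulVec_mulVec]
      have f4 : x ⬝ᵥ (S *ᵥ (Zᵀ *ᵥ w)) = x ⬝ᵥ ((S * Zᵀ) *ᵥ w) := by rw [Matrix.mulVec_mulVec]
      simp only [Matrix.mulVec_add, dotProduct_add, add_dotProduct, e0, e1, e2, f1, f2, f3, f4]
      ring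
  have h1 := congrArg (fun ξ => ∫⁻ z, g z ∂ξ) hswap
  simp only at h1
  rw [lintegral_map hg measurable_swap, Measure.lintegral_compProd hg,
    Measure.lintegral_compProd (f := fun z => g z.swap) (hg.comp measurable_swap)] at h1
  exact h1

/-- The same exchange for a scalar prior: `k` is the regression vector `v V⁻¹ h` and `τ` the
residual variance. -/
theorem lintegral_gaussian_real_swap {W V : Matrix (Fin n) (Fin n) ℝ} {h k : Fin n → ℝ} {v τ : ℝ}
    (hv : 0 ≤ v) (hτ : 0 ≤ τ) (hW : W.PosDef) (hV : V.PosDef)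
    (hVeq : V = W + v • Matrix.vecMulVec h h) (hk : V *ᵥ k = v • h) (hτv : τ + v * (k ⬝ᵥ h) = v)
    (a : Fin n → ℝ) (c : ℝ) {g : ℝ × EuclideanSpace ℝ (Fin n) → ENNReal} (hg : Measurable g) :
    ∫⁻ t, ∫⁻ y, g (t, y) ∂(multivariateGaussian (WithLp.toLp 2 (a + t • h)) W)
        ∂(gaussianReal c v.toNNReal) =
      ∫⁻ y, ∫⁻ t, g (t, y) ∂(gaussianReal (c + k ⬝ᵥ (y.ofLp - (a + c • h))) τ.toNNReal)
        ∂(multivariateGaussian (WithLp.toLp 2 (a + c • h)) V) := by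
  have m1 : Measurable fun t : ℝ => multivariateGaussian (WithLp.toLp 2 (a + t • h)) W := by
    have h : Continuous fun t : ℝ => WithLp.toLp 2 (a + t • h) := by fun_prop
    simpa using measurable_multivariateGaussian_smul hW h.measurable (measurable_const (a := 1))
  have m2 : Measurable fun y : EuclideanSpace ℝ (Fin n) =>
      gaussianReal (c + k ⬝ᵥ (y.ofLp - (a + c • h))) τ.toNNReal := by
    have h : Continuous fun y : EuclideanSpace ℝ (Fin n) => c + k ⬝ᵥ (y.ofLp - (a + c • h)) := by
      fun_prop
    exact measurable_gaussianReal.comp (h.measurable.prodMk measurable_const)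
  let κ : Kernel ℝ (EuclideanSpace ℝ (Fin n)) := ⟨_, m1⟩
  let η : Kernel (EuclideanSpace ℝ (Fin n)) ℝ := ⟨_, m2⟩
  have : IsMarkovKernel κ := ⟨fun b => by
    change IsProbabilityMeasure (multivariateGaussian _ _); infer_instance⟩
  have : IsMarkovKernel η := ⟨fun b => by
    change IsProbabilityMeasure (gaussianReal _ _); infer_instance⟩
  have hswap : gaussianReal c v.toNNReal ⊗ₘ κ =
      (multivariateGaussian (WithLp.toLp 2 (a + c • h)) V ⊗ₘ η).map Prod.swap := by
    refine gaussian_compProd_swap (m := c) (a' := c - k ⬝ᵥ (a + c • h))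
      (m' := WithLp.toLp 2 (a + c • h)) (a := WithLp.toLp 2 a)
      (L := fun t => WithLp.toLp 2 (t • h)) (L' := fun y => k ⬝ᵥ y.ofLp)
      (Ls := fun y => h ⬝ᵥ y.ofLp) (Ls' := fun t => WithLp.toLp 2 (t • k))
      (R := fun x => v * x ^ 2) (Q' := fun x => τ * x ^ 2)
      (R' := fun x => x.ofLp ⬝ᵥ (V *ᵥ x.ofLp)) (Q := fun x => x.ofLp ⬝ᵥ (W *ᵥ x.ofLp))
      ?_ ?_ ?_ ?_ ?_ ?_ ?_ ?_ ?_
    · intro e w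
      rw [inner_toLp_left, smul_dotProduct]
      simp [mul_comm]
    · intro e w
      rw [inner_toLp_right, dotProduct_smul, dotProduct_comm]
      simp
    · intro x
      rw [charFun_gaussianReal]
      simp [hv, mul_comm]
    · intro e w
      change charFun (multivariateGaussian _ _) w = _
      rw [charFun_multivariateGaussian hW.posSemidef, real_inner_comm]; rfl
    · intro w
      rw [charFun_multivariateGaussian hV.posSemidef, real_inner_comm]
    · intro f x
      change charFun (gaussianReal _ _) x = _
      rw [charFun_gaussianReal, dotProduct_sub, ← add_sub_assoc, sub_add_eq_add_sub]
      simp [hτ, mul_comm]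
    · simp
    · rw [← WithLp.toLp_add]
    · intro x w
      simp only [WithLp.ofLp_add]
      generalize w.ofLp = w
      have hVt := hV.transpose_eq
      have e1 : k ⬝ᵥ (V *ᵥ w) = v * (h ⬝ᵥ w) := by
        rw [dotProduct_mulVec_symm hVt, hk, smul_dotProduct, smul_eq_mul]
      have e2 : w ⬝ᵥ (W *ᵥ w) = w ⬝ᵥ (V *ᵥ w) - v * (h ⬝ᵥ w) ^ 2 := by
        rw [hVeq, Matrix.add_mulVec, Matrix.smul_mulVec, mulVec_vecMulVec_self, dotProduct_add,
          dotProduct_smul, dotProduct_smul, dotProduct_comm w h]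
        simp only [smul_eq_mul]; ring
      simp only [Matrix.mulVec_add, dotProduct_add, add_dotProduct, Matrix.mulVec_smul,
        dotProduct_smul, smul_dotProduct, hk, e1, e2, smul_eq_mul, dotProduct_comm w h]
      linear_combination -x ^ 2 * hτv
  have h1 := congrArg (fun ξ => ∫⁻ z, g z ∂ξ) hswap
  simp only at h1
  rw [lintegral_map hg measurable_swap, Measure.lintegral_compProd hg,
    Measure.lintegral_compProd (f := fun z => g z.swap) (hg.comp measurable_swap)] at h1
  exact h1

end Bayes

/-- Making the dependence on `u` explicit gives a form that is visibly jointly measurable and can be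
bounded in `u`. -/
theorem normalPDF_inv_smul {p : ℕ} (m : Fin p → ℝ) {S : Matrix (Fin p) (Fin p) ℝ} (hS : S.PosDef)
    {u : ℝ} (hu : 0 < u) (y : Fin p → ℝ) :
    normalPDF m (u⁻¹ • S) y = (√((2 * Real.pi) ^ p * (u⁻¹ ^ p * S.det)))⁻¹ *
      Real.exp (-(u * ((y - m) ⬝ᵥ (S⁻¹ *ᵥ (y - m)))) / 2) := by
  have e : (u⁻¹ • S)⁻¹ = u • S⁻¹ := by
    refine Matrix.inv_eq_right_inv ?_
    rw [smul_mul_smul_comm, inv_mul_cancel₀ hu.ne',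
      Matrix.mul_nonsing_inv _ (isUnit_det_of_posDef hS), one_smul]
  rw [normalPDF, e, Matrix.det_smul, Fintype.card_fin, Matrix.smul_mulVec, dotProduct_smul,
    smul_eq_mul]

namespace SMSNLMM

variable {n l q : ℕ} (θ : SMSNLMM n l q)

instance : IsProbabilityMeasure θ.H := θ.H_prob

/-! ### The kernels of the hierarchical model and its posterior kernels -/

/-- Conditional distribution of `T` given `U`. -/
def kerT : Kernel ℝ ℝ :=
  ⟨fun u => truncNormal θ.c u⁻¹ (Ioi θ.c),
    measurable_truncNormal measurable_const measurable_inv measurableSet_Ioi⟩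

/-- Conditional distribution of `b` given `T`, `U`. -/
def kerB : Kernel (ℝ × ℝ) (EuclideanSpace ℝ (Fin q)) :=
  ⟨fun w => multivariateGaussian (WithLp.toLp 2 (w.1 • θ.Delta)) (w.2⁻¹ • θ.Gam),
    measurable_multivariateGaussian_smul θ.Gam_posDef
      (by fun_prop) measurable_snd.inv⟩

/-- Conditional distribution of `Y` given `b`, `T`, `U`. -/
def kerY : Kernel (EuclideanSpace ℝ (Fin q) × ℝ × ℝ) (EuclideanSpace ℝ (Fin n)) :=
  ⟨fun w => multivariateGaussian (WithLp.toLp 2 (θ.X *ᵥ θ.β + θ.Z *ᵥ w.1.ofLp)) (w.2.2⁻¹ • θ.Sig),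
    measurable_multivariateGaussian_smul θ.Sig_posDef
      ((show Continuous fun w : EuclideanSpace ℝ (Fin q) × ℝ × ℝ =>
        WithLp.toLp 2 (θ.X *ᵥ θ.β + θ.Z *ᵥ w.1.ofLp) by fun_prop).measurable)
      measurable_snd.snd.inv⟩

theorem continuous_r : Continuous θ.r := by unfold r; fun_prop

theorem continuous_mu : Continuous θ.mu := by unfold mu; fun_prop

theorem continuous_A : Continuous θ.A := θ.continuous_mu.div_const _

@[fun_prop]
theorem measurable_A : Measurable θ.A := θ.continuous_A.measurable

/-- Conditional distribution of `b` given `T`, `U`, `Y`. -/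
def postB : Kernel (ℝ × ℝ × EuclideanSpace ℝ (Fin n)) (EuclideanSpace ℝ (Fin q)) :=
  ⟨fun w => multivariateGaussian (WithLp.toLp 2 (w.1 • θ.s + θ.r w.2.2.ofLp)) (w.2.1⁻¹ • θ.B),
    measurable_multivariateGaussian_smul θ.B_posDef
      ((show Continuous fun w : ℝ × ℝ × EuclideanSpace ℝ (Fin n) =>
        WithLp.toLp 2 (w.1 • θ.s + θ.r w.2.2.ofLp) by
          have := θ.continuous_r
          fun_prop).measurable)
      measurable_snd.fst.inv⟩

/-- Conditional distribution of `T` given `U`, `Y`. -/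
def postT : Kernel (ℝ × EuclideanSpace ℝ (Fin n)) ℝ :=
  ⟨fun w => truncNormal (θ.c + θ.mu w.2.ofLp) (w.1⁻¹ * θ.M ^ 2) (Ioi θ.c),
    measurable_truncNormal
      ((show Continuous fun w : ℝ × EuclideanSpace ℝ (Fin n) => θ.c + θ.mu w.2.ofLp by
          have := θ.continuous_mu
          fun_prop).measurable)
      (measurable_fst.inv.mul_const _) measurableSet_Ioi⟩

instance : IsFiniteKernel θ.kerT := ⟨1, ENNReal.one_lt_top, fun _ => truncNormal_univ_le _ _⟩

instance : IsFiniteKernel θ.postT := ⟨1, ENNReal.one_lt_top, fun _ => truncNormal_univ_le _ _⟩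

instance : IsMarkovKernel θ.kerB := ⟨fun _ => by
  change IsProbabilityMeasure (multivariateGaussian _ _); infer_instance⟩

instance : IsMarkovKernel θ.kerY := ⟨fun _ => by
  change IsProbabilityMeasure (multivariateGaussian _ _); infer_instance⟩

instance : IsMarkovKernel θ.postB := ⟨fun _ => by
  change IsProbabilityMeasure (multivariateGaussian _ _); infer_instance⟩

theorem isProbabilityMeasure_postT {u : ℝ} (hu : 0 < u) (y : EuclideanSpace ℝ (Fin n)) :
    IsProbabilityMeasure (θ.postT (u, y)) :=
  isProbabilityMeasure_truncNormal_Ioi _ _ (by have := θ.M_pos; positivity)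

/-- The Mahalanobis distance of `y` from the location of `Y`. -/
def mahal (y : Fin n → ℝ) : ℝ := (y - θ.loc) ⬝ᵥ (θ.Psi⁻¹ *ᵥ (y - θ.loc))

@[fun_prop]
theorem measurable_mahal : Measurable θ.mahal :=
  (show Continuous θ.mahal by unfold mahal; fun_prop).measurable

/-- The conditional density of `Y` given `U = u`. -/
def dens (u : ℝ) (y : Fin n → ℝ) : ENNReal :=
  2 * ENNReal.ofReal ((√((2 * Real.pi) ^ n * (u⁻¹ ^ n * θ.Psi.det)))⁻¹ *
    Real.exp (-(u * θ.mahal y) / 2) * stdNormalCDF (√u * θ.A y))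

theorem measurable_dens :
    Measurable fun z : ℝ × EuclideanSpace ℝ (Fin n) => θ.dens z.1 z.2.ofLp := by
  unfold dens
  fun_prop

theorem dens_eq {u : ℝ} (hu : 0 < u) (y : Fin n → ℝ) :
    θ.dens u y = 2 * ENNReal.ofReal (normalPDF θ.loc (u⁻¹ • θ.Psi) y *
      stdNormalCDF (√u * θ.A y)) := by
  rw [normalPDF_inv_smul _ θ.Psi_posDef hu]; rfl

theorem lintegral_kerB_kerY {u : ℝ} (hu : 0 < u) (t : ℝ)
    {g : EuclideanSpace ℝ (Fin q) × EuclideanSpace ℝ (Fin n) → ENNReal} (hg : Measurable g) :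
    ∫⁻ b, ∫⁻ y, g (b, y) ∂(θ.kerY (b, t, u)) ∂(θ.kerB (t, u)) =
      ∫⁻ y, ∫⁻ b, g (b, y) ∂(θ.postB (t, u, y)) ∂(multivariateGaussian
        (WithLp.toLp 2 (θ.X *ᵥ θ.β + t • θ.ZDelta)) (u⁻¹ • θ.Omega)) := by
  have hi : 0 < u⁻¹ := inv_pos.2 hu
  have h := lintegral_gaussian_linear_swap (S := u⁻¹ • θ.Gam) (B := u⁻¹ • θ.B) (Sg := u⁻¹ • θ.Sig)
    (W := u⁻¹ • θ.Omega) (Z := θ.Z) (K := θ.gain) (θ.Gam_posDef.smul hi) (θ.B_posDef.smul hi)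
    (θ.Sig_posDef.smul hi) (θ.Omega_posDef.smul hi)
    (by rw [Omega, smul_add, Matrix.mul_smul, Matrix.smul_mul])
    (by rw [Matrix.mul_smul, gain_mul_Omega, Matrix.smul_mul])
    (by rw [Matrix.mul_smul, ← smul_add, B_add_gain]) (θ.X *ᵥ θ.β) (t • θ.Delta) hg
  -- The posterior mean is affine in `t`; its slope is `s` and its intercept `r`.
  have e : ∀ y : Fin n → ℝ, t • θ.Delta + θ.gain *ᵥ (y - (θ.X *ᵥ θ.β + θ.Z *ᵥ (t • θ.Delta))) =
      t • θ.s + θ.r y := by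
    intro y
    rw [← sub_sub, Matrix.mulVec_sub, s, r, Matrix.sub_mulVec, Matrix.one_mulVec,
      Matrix.mulVec_mulVec, Matrix.mulVec_smul, ← gain, smul_sub]
    abel
  simp only [e] at h
  simp only [Matrix.mulVec_smul] at h
  exact h

theorem lintegral_kerT {u : ℝ} (hu : 0 < u) (f : ℝ → ENNReal) :
    ∫⁻ t, f t ∂(θ.kerT u) = 2 * ∫⁻ t in Ioi θ.c, f t ∂(gaussianReal θ.c u⁻¹.toNNReal) := by
  rw [setLIntegral_Ioi_gaussianReal _ _ (inv_pos.2 hu), sub_self, zero_div, stdNormalCDF_zero,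
    ← mul_assoc]
  have : (2 : ENNReal) * ENNReal.ofReal (1 / 2) = 1 := by
    rw [← ENNReal.ofReal_ofNat, ← ENNReal.ofReal_mul (by norm_num)]
    norm_num
  rw [this, one_mul]
  rfl

theorem mean_div_sqrt_var {u : ℝ} (hu : 0 < u) (y : Fin n → ℝ) :
    (θ.c + θ.mu y - θ.c) / √(u⁻¹ * θ.M ^ 2) = √u * θ.A y := by
  have hM := θ.M_pos
  rw [add_sub_cancel_left, Real.sqrt_mul (inv_pos.2 hu).le, Real.sqrt_sq hM.le, Real.sqrt_inv, A]
  have := Real.sqrt_pos.2 hu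
  field_simp

theorem lintegral_kerT_gaussian {u : ℝ} (hu : 0 < u)
    {g : ℝ × EuclideanSpace ℝ (Fin n) → ENNReal} (hg : Measurable g) :
    ∫⁻ t, ∫⁻ y, g (t, y) ∂(multivariateGaussian
        (WithLp.toLp 2 (θ.X *ᵥ θ.β + t • θ.ZDelta)) (u⁻¹ • θ.Omega)) ∂(θ.kerT u) =
      ∫⁻ y, θ.dens u y.ofLp * ∫⁻ t, g (t, y) ∂(θ.postT (u, y)) := by
  have hi : 0 < u⁻¹ := inv_pos.2 hu
  have hM := θ.M_pos
  have hP := isUnit_det_of_posDef θ.Psi_posDef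
  have hτ : 0 < u⁻¹ * θ.M ^ 2 := by positivity
  -- The truncation is moved into the test function as an indicator, so that the exchange is made
  -- for the untruncated Gaussian prior.
  have hind : Measurable fun z : ℝ × EuclideanSpace ℝ (Fin n) =>
      (Ioi θ.c).indicator (fun t => g (t, z.2)) z.1 := by
    have := hg.indicator (measurable_fst (measurableSet_Ioi (a := θ.c)))
    convert! this using 1
  have h := lintegral_gaussian_real_swap (W := u⁻¹ • θ.Omega) (V := u⁻¹ • θ.Psi) (h := θ.ZDelta)
    (k := θ.Psi⁻¹ *ᵥ θ.ZDelta) (v := u⁻¹) (τ := u⁻¹ * θ.M ^ 2) hi.le hτ.le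
    (θ.Omega_posDef.smul hi) (θ.Psi_posDef.smul hi) (by rw [Psi_eq, smul_add])
    (by rw [Matrix.smul_mulVec, Matrix.mulVec_mulVec, Matrix.mul_nonsing_inv _ hP,
      Matrix.one_mulVec])
    (by rw [dotProduct_comm, ← mul_add, M_sq_eq, mul_one]) (θ.X *ᵥ θ.β) θ.c hind
  have hloc : θ.X *ᵥ θ.β + θ.c • θ.ZDelta = θ.loc := rfl
  simp only [hloc, ← mu_eq] at h
  rw [lintegral_kerT θ hu, ← lintegral_indicator measurableSet_Ioi]
  have e1 : ∀ t, (Ioi θ.c).indicator (fun t => ∫⁻ y, g (t, y) ∂(multivariateGaussian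
        (WithLp.toLp 2 (θ.X *ᵥ θ.β + t • θ.ZDelta)) (u⁻¹ • θ.Omega))) t =
      ∫⁻ y, (Ioi θ.c).indicator (fun t => g (t, y)) t ∂(multivariateGaussian
        (WithLp.toLp 2 (θ.X *ᵥ θ.β + t • θ.ZDelta)) (u⁻¹ • θ.Omega)) := by
    intro t
    by_cases ht : t ∈ Ioi θ.c <;> simp [ht]
  simp only [e1]
  rw [h]
  simp only [lintegral_indicator (measurableSet_Ioi (a := θ.c)),
    setLIntegral_Ioi_gaussianReal _ _ hτ]
  simp only [θ.mean_div_sqrt_var hu]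
  have hpost : Measurable fun y : EuclideanSpace ℝ (Fin n) => ∫⁻ t, g (t, y) ∂(θ.postT (u, y)) := by
    have h1 : Measurable fun z : (ℝ × EuclideanSpace ℝ (Fin n)) × ℝ => g (z.2, z.1.2) := by
      fun_prop
    exact (Measurable.lintegral_kernel_prod_right' (κ := θ.postT) h1).comp
      (measurable_prodMk_left (x := u))
  have hm1 : Measurable fun y : EuclideanSpace ℝ (Fin n) =>
      ENNReal.ofReal (stdNormalCDF (√u * θ.A y.ofLp)) := by fun_prop
  change 2 * ∫⁻ y, ENNReal.ofReal (stdNormalCDF (√u * θ.A y.ofLp)) *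
    (∫⁻ t, g (t, y) ∂(θ.postT (u, y))) ∂_ = _
  rw [multivariateGaussian_eq_withDensity (θ.Psi_posDef.smul hi),
    lintegral_withDensity_eq_lintegral_mul _ (by fun_prop) (g := fun y =>
      ENNReal.ofReal (stdNormalCDF (√u * θ.A y.ofLp)) * ∫⁻ t, g (t, y) ∂(θ.postT (u, y)))
      (hm1.mul hpost),
    ← lintegral_const_mul _ (by fun_prop)]
  refine lintegral_congr fun y => ?_
  rw [θ.dens_eq hu, ENNReal.ofReal_mul (normalPDF_nonneg _ _ _)]
  simp only [Pi.mul_apply]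
  ring

variable {θ} {Ω : Type*} [MeasurableSpace Ω] {P : Measure Ω} [IsProbabilityMeasure P]
  {U T : Ω → ℝ} {b : Ω → EuclideanSpace ℝ (Fin q)} {Y : Ω → EuclideanSpace ℝ (Fin n)}

/-- The hierarchy is unfolded from `Y` up to `U`; then `b` and `Y` are exchanged at fixed `t`, and
finally `T` and `Y`. Since `H` charges only positive `u`, both exchanges are available almost
everywhere. -/
theorem IsModel.lintegral_eq (h : θ.IsModel P U T b Y)
    {g : ℝ × ℝ × EuclideanSpace ℝ (Fin q) × EuclideanSpace ℝ (Fin n) → ENNReal}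
    (hg : Measurable g) :
    ∫⁻ ω, g (U ω, T ω, b ω, Y ω) ∂P = ∫⁻ u, (∫⁻ y, θ.dens u y.ofLp *
      ∫⁻ t, ∫⁻ b, g (u, t, b, y) ∂(θ.postB (t, u, y)) ∂(θ.postT (u, y))) ∂θ.H := by
  have hU := h.measurable_U
  have hT := h.measurable_T
  have hb := h.measurable_b
  have hY := h.measurable_Y
  have lT : CondLaw T U P θ.kerT := h.law_T
  have lb : CondLaw b (fun ω => (T ω, U ω)) P θ.kerB := h.law_b
  have lY : CondLaw Y (fun ω => (b ω, T ω, U ω)) P θ.kerY := h.law_Y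
  have m1 : Measurable fun z : (EuclideanSpace ℝ (Fin q) × ℝ × ℝ) × EuclideanSpace ℝ (Fin n) =>
      g (z.1.2.2, z.1.2.1, z.1.1, z.2) := by fun_prop
  have m2 : Measurable fun w : EuclideanSpace ℝ (Fin q) × ℝ × ℝ =>
      ∫⁻ y, g (w.2.2, w.2.1, w.1, y) ∂(θ.kerY w) :=
    Measurable.lintegral_kernel_prod_right' (κ := θ.kerY) m1
  have m2' : Measurable fun z : (ℝ × ℝ) × EuclideanSpace ℝ (Fin q) =>
      ∫⁻ y, g (z.1.2, z.1.1, z.2, y) ∂(θ.kerY (z.2, z.1.1, z.1.2)) :=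
    m2.comp (show Measurable fun z : (ℝ × ℝ) × EuclideanSpace ℝ (Fin q) =>
      (z.2, z.1.1, z.1.2) by fun_prop)
  have m3 : Measurable fun w : ℝ × ℝ =>
      ∫⁻ b, ∫⁻ y, g (w.2, w.1, b, y) ∂(θ.kerY (b, w.1, w.2)) ∂(θ.kerB w) :=
    Measurable.lintegral_kernel_prod_right' (κ := θ.kerB) m2'
  have m3' : Measurable fun z : ℝ × ℝ =>
      ∫⁻ b, ∫⁻ y, g (z.1, z.2, b, y) ∂(θ.kerY (b, z.2, z.1)) ∂(θ.kerB (z.2, z.1)) :=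
    m3.comp measurable_swap
  have m4 : Measurable fun u : ℝ => ∫⁻ t,
      ∫⁻ b, ∫⁻ y, g (u, t, b, y) ∂(θ.kerY (b, t, u)) ∂(θ.kerB (t, u)) ∂(θ.kerT u) :=
    Measurable.lintegral_kernel_prod_right' (κ := θ.kerT) m3'
  rw [lY.lintegral_prodMk hY (by fun_prop) m1, lb.lintegral_prodMk hb (by fun_prop) m2',
    lT.lintegral_prodMk hT hU m3', ← h.law_U, ← lintegral_map m4 hU, h.law_U]
  refine lintegral_congr_ae ?_
  filter_upwards [θ.H_pos] with u hu
  have m5 : Measurable fun z : ℝ × EuclideanSpace ℝ (Fin n) =>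
      ∫⁻ b, g (u, z.1, b, z.2) ∂(θ.postB (z.1, u, z.2)) := by
    have h1 : Measurable fun z : (ℝ × ℝ × EuclideanSpace ℝ (Fin n)) × EuclideanSpace ℝ (Fin q) =>
      g (z.1.2.1, z.1.1, z.2, z.1.2.2) := by fun_prop
    exact (Measurable.lintegral_kernel_prod_right' (κ := θ.postB) h1).comp
      (show Measurable fun z : ℝ × EuclideanSpace ℝ (Fin n) => (z.1, u, z.2) by fun_prop)
  rw [← lintegral_kerT_gaussian θ hu m5]
  refine lintegral_congr fun t => ?_
  exact lintegral_kerB_kerY θ hu t (g := fun z => g (u, t, z.1, z.2)) (by fun_prop)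

end SMSNLMM

namespace SMSNLMM

variable {n l q : ℕ} (θ : SMSNLMM n l q)

/-! ### The marginal law of `Y` and the posterior of the latent variables -/

/-- The marginal density of `Y`. -/
def margDens (y : EuclideanSpace ℝ (Fin n)) : ENNReal := ∫⁻ u, θ.dens u y.ofLp ∂θ.H

@[fun_prop]
theorem measurable_margDens : Measurable θ.margDens :=
  θ.measurable_dens.lintegral_prod_left'

theorem smsn_eq : smsn θ.loc θ.Psi θ.lamBar θ.H = volume.withDensity θ.margDens := by
  unfold smsn
  congr 1
  ext y
  have hr : θ.H.restrict (Ioi 0) = θ.H := Measure.restrict_eq_self_of_ae_mem θ.H_pos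
  rw [smsnPDF, hr, margDens, ← lintegral_const_mul' _ _ (by norm_num)]
  refine lintegral_congr_ae ?_
  filter_upwards [θ.H_pos] with u hu
  rw [θ.dens_eq hu, A_eq]

/-- Conditional distribution of `U` given `Y`. -/
def postU : Kernel (EuclideanSpace ℝ (Fin n)) ℝ :=
  ⟨fun y => (θ.margDens y)⁻¹ • θ.H.withDensity fun u => θ.dens u y.ofLp, by
    refine Measure.measurable_of_measurable_coe _ fun s hs => ?_
    simp only [Measure.smul_apply, withDensity_apply _ hs, smul_eq_mul]
    have h : Measurable fun y : EuclideanSpace ℝ (Fin n) =>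
        ∫⁻ u in s, θ.dens u y.ofLp ∂θ.H :=
      Measurable.lintegral_prod_left' (μ := θ.H.restrict s) θ.measurable_dens
    exact (Measurable.inv θ.measurable_margDens).mul h⟩

theorem measurable_dens_left (y : EuclideanSpace ℝ (Fin n)) :
    Measurable fun u => θ.dens u y.ofLp := by
  unfold dens
  fun_prop

/-- The product is 1 only where the marginal density is neither 0 nor `∞`; elsewhere it is 0 and
`postU` is the zero measure. -/
theorem postU_univ (y : EuclideanSpace ℝ (Fin n)) :
    θ.postU y univ = (θ.margDens y)⁻¹ * θ.margDens y := by
  change ((θ.margDens y)⁻¹ • θ.H.withDensity _) univ = _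
  rw [Measure.smul_apply, withDensity_apply _ .univ, Measure.restrict_univ]
  rfl

theorem lintegral_postU (y : EuclideanSpace ℝ (Fin n)) {f : ℝ → ENNReal} (hf : Measurable f) :
    ∫⁻ u, f u ∂(θ.postU y) = (θ.margDens y)⁻¹ * ∫⁻ u, θ.dens u y.ofLp * f u ∂θ.H := by
  change ∫⁻ u, f u ∂((θ.margDens y)⁻¹ • θ.H.withDensity _) = _
  rw [lintegral_smul_measure, lintegral_withDensity_eq_lintegral_mul _
    (θ.measurable_dens_left y) hf]
  rfl

theorem postU_pos (y : EuclideanSpace ℝ (Fin n)) : ∀ᵐ u ∂(θ.postU y), 0 < u := by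
  have h1 : θ.H.withDensity (fun u => θ.dens u y.ofLp) ≪ θ.H := withDensity_absolutelyContinuous _ _
  exact (Measure.smul_absolutelyContinuous (c := (θ.margDens y)⁻¹)).trans h1 |>.ae_le θ.H_pos

instance : IsFiniteKernel θ.postU := ⟨1, ENNReal.one_lt_top, fun y => by
  rw [postU_univ]; exact ENNReal.inv_mul_le_one _⟩

/-- `postT` at a fixed value of `Y`. -/
def postTy (y : EuclideanSpace ℝ (Fin n)) : Kernel ℝ ℝ :=
  θ.postT.comap (fun u => (u, y)) (by fun_prop)

/-- `postB` at a fixed value of `Y`. -/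
def postBy (y : EuclideanSpace ℝ (Fin n)) : Kernel (ℝ × ℝ) (EuclideanSpace ℝ (Fin q)) :=
  θ.postB.comap (fun z => (z.2, z.1, y)) (by fun_prop)

instance (y : EuclideanSpace ℝ (Fin n)) : IsFiniteKernel (θ.postTy y) := by
  unfold postTy; infer_instance

instance (y : EuclideanSpace ℝ (Fin n)) : IsMarkovKernel (θ.postBy y) := by
  unfold postBy; infer_instance

/-- Conditional distribution of `(U, T, b)` given `Y`. -/
def postAll : Kernel (EuclideanSpace ℝ (Fin n)) (ℝ × ℝ × EuclideanSpace ℝ (Fin q)) :=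
  ((θ.postU ⊗ₖ θ.postT.comap Prod.swap measurable_swap) ⊗ₖ
    θ.postB.comap (fun z : EuclideanSpace ℝ (Fin n) × ℝ × ℝ => (z.2.2, z.2.1, z.1))
      (by fun_prop)).map MeasurableEquiv.prodAssoc

instance : IsFiniteKernel θ.postAll := by unfold postAll; infer_instance

theorem postAll_apply (y : EuclideanSpace ℝ (Fin n)) :
    θ.postAll y = ((θ.postU y ⊗ₘ θ.postTy y) ⊗ₘ θ.postBy y).map MeasurableEquiv.prodAssoc := by
  rw [postAll, Kernel.map_apply _ (MeasurableEquiv.measurable _),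
    Kernel.compProd_apply_eq_compProd_sectR, Kernel.compProd_apply_eq_compProd_sectR]
  congr 2

theorem lintegral_postAll (y : EuclideanSpace ℝ (Fin n))
    {f : ℝ × ℝ × EuclideanSpace ℝ (Fin q) → ENNReal} (hf : Measurable f) :
    ∫⁻ z, f z ∂(θ.postAll y) = (θ.margDens y)⁻¹ * ∫⁻ u, θ.dens u y.ofLp *
      ∫⁻ t, ∫⁻ b, f (u, t, b) ∂(θ.postB (t, u, y)) ∂(θ.postT (u, y)) ∂θ.H := by
  have m1 : Measurable fun z : (ℝ × ℝ) × EuclideanSpace ℝ (Fin q) => f (z.1.1, z.1.2, z.2) := by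
    fun_prop
  have m2 : Measurable fun z : ℝ × ℝ => ∫⁻ b, f (z.1, z.2, b) ∂(θ.postBy y z) :=
    Measurable.lintegral_kernel_prod_right' m1
  have m3 : Measurable fun u => ∫⁻ t, ∫⁻ b, f (u, t, b) ∂(θ.postBy y (u, t)) ∂(θ.postTy y u) :=
    Measurable.lintegral_kernel_prod_right' m2
  rw [postAll_apply, lintegral_map hf (MeasurableEquiv.measurable _),
    Measure.lintegral_compProd (f := fun z : (ℝ × ℝ) × EuclideanSpace ℝ (Fin q) =>
      f (MeasurableEquiv.prodAssoc z)) (hf.comp (MeasurableEquiv.measurable _))]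
  change ∫⁻ z, (∫⁻ b, f (z.1, z.2, b) ∂(θ.postBy y z)) ∂_ = _
  rw [Measure.lintegral_compProd (f := fun z => ∫⁻ b, f (z.1, z.2, b) ∂(θ.postBy y z)) m2]
  exact lintegral_postU θ y m3

variable {θ} {Ω : Type*} [MeasurableSpace Ω] {P : Measure Ω} [IsProbabilityMeasure P]
  {U T : Ω → ℝ} {b : Ω → EuclideanSpace ℝ (Fin q)} {Y : Ω → EuclideanSpace ℝ (Fin n)}

theorem IsModel.condLaw_b (h : θ.IsModel P U T b Y) :
    CondLaw b (fun ω => (T ω, U ω, Y ω)) P θ.postB := by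
  have hU := h.measurable_U
  have hT := h.measurable_T
  have hb := h.measurable_b
  have hY := h.measurable_Y
  refine CondLaw.of_lintegral hb (by fun_prop) fun f hf => ?_
  have m1 : Measurable fun w : ℝ × ℝ × EuclideanSpace ℝ (Fin n) =>
      ∫⁻ v, f (w, v) ∂(θ.postB w) := Measurable.lintegral_kernel_prod_right' hf
  have e1 := h.lintegral_eq (g := fun z => f ((z.2.1, z.1, z.2.2.2), z.2.2.1)) (by fun_prop)
  have e2 := h.lintegral_eq
    (g := fun z => ∫⁻ v, f ((z.2.1, z.1, z.2.2.2), v) ∂(θ.postB (z.2.1, z.1, z.2.2.2)))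
    (m1.comp (show Measurable fun z : ℝ × ℝ × EuclideanSpace ℝ (Fin q) × EuclideanSpace ℝ (Fin n) =>
      (z.2.1, z.1, z.2.2.2) by fun_prop))
  simp only [lintegral_const, measure_univ, mul_one] at e2
  rw [e1, e2]

theorem IsModel.condLaw_T (h : θ.IsModel P U T b Y) :
    CondLaw T (fun ω => (U ω, Y ω)) P θ.postT := by
  have hU := h.measurable_U
  have hT := h.measurable_T
  have hb := h.measurable_b
  have hY := h.measurable_Y
  refine CondLaw.of_lintegral hT (by fun_prop) fun f hf => ?_
  have m1 : Measurable fun w : ℝ × EuclideanSpace ℝ (Fin n) =>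
      ∫⁻ v, f (w, v) ∂(θ.postT w) := Measurable.lintegral_kernel_prod_right' hf
  have e1 := h.lintegral_eq (g := fun z => f ((z.1, z.2.2.2), z.2.1)) (by fun_prop)
  have e2 := h.lintegral_eq
    (g := fun z => ∫⁻ v, f ((z.1, z.2.2.2), v) ∂(θ.postT (z.1, z.2.2.2)))
    (m1.comp (show Measurable fun z : ℝ × ℝ × EuclideanSpace ℝ (Fin q) × EuclideanSpace ℝ (Fin n) =>
      (z.1, z.2.2.2) by fun_prop))
  simp only [lintegral_const, measure_univ, mul_one] at e1 e2
  rw [e1, e2]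
  -- `postT` is known to have total mass one only for `u > 0`.
  refine lintegral_congr_ae ?_
  filter_upwards [θ.H_pos] with u hu
  refine lintegral_congr fun y => ?_
  have := θ.isProbabilityMeasure_postT hu y
  rw [measure_univ, mul_one]

theorem IsModel.lintegral_Y (h : θ.IsModel P U T b Y) {f : EuclideanSpace ℝ (Fin n) → ENNReal}
    (hf : Measurable f) : ∫⁻ ω, f (Y ω) ∂P = ∫⁻ y, θ.margDens y * f y := by
  have e1 := h.lintegral_eq (g := fun z => f z.2.2.2) (by fun_prop)
  have hd := θ.measurable_dens
  have e2 : ∫⁻ u, (∫⁻ y, θ.dens u y.ofLp *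
      ∫⁻ t, ∫⁻ b, f y ∂(θ.postB (t, u, y)) ∂(θ.postT (u, y))) ∂θ.H =
      ∫⁻ u, (∫⁻ y : EuclideanSpace ℝ (Fin n), θ.dens u y.ofLp * f y) ∂θ.H := by
    refine lintegral_congr_ae ?_
    filter_upwards [θ.H_pos] with u hu
    refine lintegral_congr fun y => ?_
    have := θ.isProbabilityMeasure_postT hu y
    simp
  rw [e1, e2, lintegral_lintegral_swap (by fun_prop)]
  refine lintegral_congr fun y => ?_
  rw [lintegral_mul_const _ (θ.measurable_dens_left y)]
  rfl

theorem IsModel.map_Y (h : θ.IsModel P U T b Y) :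
    P.map Y = volume.withDensity θ.margDens := by
  refine Measure.ext_of_lintegral _ fun f hf => ?_
  rw [lintegral_map hf h.measurable_Y, h.lintegral_Y hf,
    lintegral_withDensity_eq_lintegral_mul _ θ.measurable_margDens hf]
  rfl

theorem IsModel.ae_margDens_lt_top (h : θ.IsModel P U T b Y) :
    ∀ᵐ y : EuclideanSpace ℝ (Fin n), θ.margDens y < ⊤ := by
  have h1 := h.lintegral_Y (f := fun _ => 1) measurable_const
  simp only [lintegral_const, measure_univ, mul_one] at h1
  exact ae_lt_top θ.measurable_margDens (by rw [← h1]; exact ENNReal.one_ne_top)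

theorem IsModel.condLaw_latent (h : θ.IsModel P U T b Y) :
    CondLaw (fun ω => (U ω, T ω, b ω)) Y P θ.postAll := by
  have hU := h.measurable_U
  have hT := h.measurable_T
  have hb := h.measurable_b
  have hY := h.measurable_Y
  refine CondLaw.of_lintegral (by fun_prop) hY fun f hf => ?_
  have e1 := h.lintegral_eq (g := fun z => f (z.2.2.2, z.1, z.2.1, z.2.2.1)) (by fun_prop)
  have m0 : Measurable fun y => ∫⁻ v, f (y, v) ∂(θ.postAll y) :=
    Measurable.lintegral_kernel_prod_right' hf
  have m1 : Measurable fun w : ℝ × ℝ × EuclideanSpace ℝ (Fin n) =>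
      ∫⁻ b, f (w.2.2, w.2.1, w.1, b) ∂(θ.postB w) :=
    Measurable.lintegral_kernel_prod_right' (κ := θ.postB)
      (f := fun z => f (z.1.2.2, z.1.2.1, z.1.1, z.2)) (by fun_prop)
  have m2 : Measurable fun w : ℝ × EuclideanSpace ℝ (Fin n) =>
      ∫⁻ t, ∫⁻ b, f (w.2, w.1, t, b) ∂(θ.postB (t, w.1, w.2)) ∂(θ.postT w) :=
    Measurable.lintegral_kernel_prod_right' (κ := θ.postT) (m1.comp
      (show Measurable fun z : (ℝ × EuclideanSpace ℝ (Fin n)) × ℝ => (z.2, z.1.1, z.1.2) by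
        fun_prop))
  have m3 := θ.measurable_dens.mul m2
  rw [e1, h.lintegral_Y m0, lintegral_lintegral_swap m3.aemeasurable]
  refine lintegral_congr_ae ?_
  filter_upwards [h.ae_margDens_lt_top] with y hy
  rw [lintegral_postAll θ y (f := fun v => f (y, v)) (by fun_prop), ← mul_assoc]
  -- Where the marginal density vanishes, so does the conditional density for `H`-almost every `u`,
  -- and both sides are zero.
  by_cases h0 : θ.margDens y = 0
  · rw [h0, zero_mul, zero_mul]
    rw [margDens, lintegral_eq_zero_iff (θ.measurable_dens_left y)] at h0
    refine (lintegral_congr_ae ?_).trans lintegral_zero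
    filter_upwards [h0] with u hu
    simp only [Pi.zero_apply] at hu
    simp [hu]
  · rw [ENNReal.mul_inv_cancel h0 hy.ne, one_mul]

end SMSNLMM

/-! ### Elementary bounds for the posterior weights -/

theorem one_add_pow_mul_exp_neg_le {d : ℝ} (hd : 0 < d) (m : ℕ) {u : ℝ} (hu : 0 < u) :
    (1 + u) ^ m * Real.exp (-(u * d) / 2) ≤ m.factorial * (2 / d) ^ m * Real.exp (d / 2) := by
  -- The bound is `x ^ m / m! ≤ exp x` at `x = (1 + u) d / 2`; the shift by one leaves the factor
  -- `exp (d / 2)`.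
  have hx : 0 ≤ (1 + u) * (d / 2) := by positivity
  have h := Real.pow_div_factorial_le_exp _ hx m
  rw [div_le_iff₀ (by positivity), mul_pow] at h
  have h2 : (1 + u) ^ m = ((1 + u) ^ m * (d / 2) ^ m) * (2 / d) ^ m := by
    rw [mul_assoc, ← mul_pow, div_mul_div_comm, mul_comm d 2, div_self (by positivity), one_pow,
      mul_one]
  have h3 : Real.exp ((1 + u) * (d / 2)) * Real.exp (-(u * d) / 2) = Real.exp (d / 2) := by
    rw [← Real.exp_add]; congr 1; ring
  calc (1 + u) ^ m * Real.exp (-(u * d) / 2)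
      = ((1 + u) ^ m * (d / 2) ^ m) * (2 / d) ^ m * Real.exp (-(u * d) / 2) := by rw [← h2]
    _ ≤ (Real.exp ((1 + u) * (d / 2)) * m.factorial) * (2 / d) ^ m *
          Real.exp (-(u * d) / 2) := by gcongr
    _ = m.factorial * (2 / d) ^ m *
          (Real.exp ((1 + u) * (d / 2)) * Real.exp (-(u * d) / 2)) := by ring
    _ = _ := by rw [h3]

theorem inv_sqrt_mul_inv_pow_le {a D : ℝ} (p : ℕ) {u : ℝ} (hu : 0 < u) :
    (√(a * (u⁻¹ ^ p * D)))⁻¹ ≤ (√(a * D))⁻¹ * (1 + u) ^ p := by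
  have e : a * (u⁻¹ ^ p * D) = a * D * (u ^ p)⁻¹ := by rw [inv_pow]; ring
  rw [e, Real.sqrt_mul' _ (by positivity), Real.sqrt_inv, mul_inv, inv_inv]
  have : √(u ^ p) ≤ (1 + u) ^ p := by
    rw [Real.sqrt_le_iff]
    refine ⟨by positivity, ?_⟩
    rw [← pow_mul, mul_comm p 2, pow_mul]
    gcongr
    nlinarith
  gcongr

theorem gaussianPDFReal_std_le_one (x : ℝ) : gaussianPDFReal 0 1 x ≤ 1 := by
  simp only [gaussianPDFReal, NNReal.coe_one, mul_one, sub_zero]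
  have h1 : (√(2 * Real.pi))⁻¹ ≤ 1 := by
    refine inv_le_one_of_one_le₀ (Real.one_le_sqrt.2 ?_)
    linarith [Real.pi_gt_three]
  have h2 : Real.exp (-x ^ 2 / 2) ≤ 1 := Real.exp_le_one_iff.2 (by nlinarith [sq_nonneg x])
  exact mul_le_one₀ h1 (Real.exp_nonneg _) h2

theorem WPhi_nonneg (x : ℝ) : 0 ≤ WPhi x :=
  div_nonneg (gaussianPDFReal_nonneg _ _ _) (stdNormalCDF_pos x).le

@[fun_prop]
theorem measurable_WPhi : Measurable WPhi :=
  (measurable_gaussianPDFReal 0 1).div measurable_stdNormalCDF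

namespace SMSNLMM

variable {n l q : ℕ} (θ : SMSNLMM n l q)

/-! ### Integrability under the posterior of `U` -/

theorem mahal_pos {y : Fin n → ℝ} (hy : y ≠ θ.loc) : 0 < θ.mahal y := by
  have := θ.Psi_posDef.inv.dotProduct_mulVec_pos (sub_ne_zero.2 hy)
  simpa [mahal] using this

/-- Against the density, `|f|` times its factor `Φ` is at most `1 + u`, the normalising factor is at
most a constant times `(1 + u) ^ n`, and the exponential absorbs the resulting power `n + 1`. The
integrand is thus bounded and `H` is finite. Keeping `Φ` in the hypothesis lets `W_Φ` be treated
without a lower bound on `Φ`. -/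
theorem integrable_postU {y : EuclideanSpace ℝ (Fin n)} (hy : y.ofLp ≠ θ.loc)
    (hπ : θ.margDens y ≠ 0) {f : ℝ → ℝ} (hf : Measurable f)
    (hb : ∀ u, 0 < u → |f u| * stdNormalCDF (√u * θ.A y.ofLp) ≤ 1 + u) :
    Integrable f (θ.postU y) := by
  have hd := θ.mahal_pos hy
  set d := θ.mahal y.ofLp with hddef
  set C := (√((2 * Real.pi) ^ n * θ.Psi.det))⁻¹ *
    ((n + 1).factorial * (2 / d) ^ (n + 1) * Real.exp (d / 2)) with hC
  refine ⟨hf.aestronglyMeasurable, ?_⟩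
  rw [hasFiniteIntegral_iff_enorm, θ.lintegral_postU y hf.enorm]
  refine ENNReal.mul_lt_top (ENNReal.inv_lt_top.2 (pos_iff_ne_zero.2 hπ)) ?_
  have hle : ∫⁻ u, θ.dens u y.ofLp * ‖f u‖ₑ ∂θ.H ≤ ∫⁻ u, 2 * ENNReal.ofReal C ∂θ.H := by
    refine lintegral_mono_ae ?_
    filter_upwards [θ.H_pos] with u hu
    rw [dens, ← hddef, mul_assoc, ← ofReal_norm, ← ENNReal.ofReal_mul
      (by have := stdNormalCDF_pos (√u * θ.A y.ofLp); positivity), Real.norm_eq_abs]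
    gcongr
    have h1 := inv_sqrt_mul_inv_pow_le (a := (2 * Real.pi) ^ n) (D := θ.Psi.det) n hu
    have h2 := one_add_pow_mul_exp_neg_le hd (n + 1) hu
    calc _ = (√((2 * Real.pi) ^ n * (u⁻¹ ^ n * θ.Psi.det)))⁻¹ * Real.exp (-(u * d) / 2) *
          (|f u| * stdNormalCDF (√u * θ.A y.ofLp)) := by ring
      _ ≤ ((√((2 * Real.pi) ^ n * θ.Psi.det))⁻¹ * (1 + u) ^ n) * Real.exp (-(u * d) / 2) *
          (1 + u) := by
        have h3 := hb u hu
        have h4 : 0 ≤ |f u| * stdNormalCDF (√u * θ.A y.ofLp) :=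
          mul_nonneg (abs_nonneg _) (stdNormalCDF_pos _).le
        gcongr
      _ = (√((2 * Real.pi) ^ n * θ.Psi.det))⁻¹ *
          ((1 + u) ^ (n + 1) * Real.exp (-(u * d) / 2)) := by ring
      _ ≤ C := by rw [hC]; gcongr
  refine hle.trans_lt ?_
  simp [ENNReal.mul_lt_top]

theorem integrable_id_postU {y : EuclideanSpace ℝ (Fin n)} (hy : y.ofLp ≠ θ.loc)
    (hπ : θ.margDens y ≠ 0) : Integrable (fun u => u) (θ.postU y) := by
  refine θ.integrable_postU hy hπ (by fun_prop) fun u hu => ?_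
  rw [abs_of_pos hu]
  nlinarith [stdNormalCDF_le_one (√u * θ.A y.ofLp), stdNormalCDF_pos (√u * θ.A y.ofLp)]

theorem integrable_WPhi_postU {y : EuclideanSpace ℝ (Fin n)} (hy : y.ofLp ≠ θ.loc)
    (hπ : θ.margDens y ≠ 0) :
    Integrable (fun u => √u * WPhi (√u * θ.A y.ofLp)) (θ.postU y) := by
  refine θ.integrable_postU hy hπ (by fun_prop) fun u hu => ?_
  have hs := Real.sq_sqrt hu.le
  rw [abs_of_nonneg (mul_nonneg (Real.sqrt_nonneg u) (WPhi_nonneg _)), mul_assoc, WPhi,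
    div_mul_cancel₀ _ (stdNormalCDF_pos _).ne']
  nlinarith [gaussianPDFReal_std_le_one (√u * θ.A y.ofLp), Real.sqrt_nonneg u,
    sq_nonneg (√u - 1)]

/-! ### Posterior moments -/

theorem sqrt_var_mul {u : ℝ} (hu : 0 < u) : u * √(u⁻¹ * θ.M ^ 2) = θ.M * √u := by
  rw [Real.sqrt_mul (inv_pos.2 hu).le, Real.sqrt_sq θ.M_pos.le, Real.sqrt_inv]
  nth_rw 1 [← Real.mul_self_sqrt hu.le]
  have := Real.sqrt_pos.2 hu
  field_simp

theorem var_pos {u : ℝ} (hu : 0 < u) : 0 < u⁻¹ * θ.M ^ 2 := by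
  have := θ.M_pos
  positivity

section Posterior

variable (y : EuclideanSpace ℝ (Fin n))

theorem mul_integral_postTy {u : ℝ} (hu : 0 < u) :
    u * ∫ t, t ∂(θ.postTy y u) =
      (θ.mu y.ofLp + θ.c) * u + θ.M * (√u * WPhi (√u * θ.A y.ofLp)) := by
  change u * ∫ t, t ∂(truncNormal (θ.c + θ.mu y.ofLp) (u⁻¹ * θ.M ^ 2) (Ioi θ.c)) = _
  rw [integral_id_truncNormal_Ioi _ _ (θ.var_pos hu), θ.mean_div_sqrt_var hu, mul_add, ← mul_assoc,
    θ.sqrt_var_mul hu]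
  ring

theorem mul_integral_sq_postTy {u : ℝ} (hu : 0 < u) :
    u * ∫ t, t ^ 2 ∂(θ.postTy y u) = θ.M ^ 2 + (θ.mu y.ofLp + θ.c) ^ 2 * u +
      θ.M * (θ.mu y.ofLp + 2 * θ.c) * (√u * WPhi (√u * θ.A y.ofLp)) := by
  change u * ∫ t, t ^ 2 ∂(truncNormal (θ.c + θ.mu y.ofLp) (u⁻¹ * θ.M ^ 2) (Ioi θ.c)) = _
  rw [integral_sq_truncNormal_Ioi _ _ (θ.var_pos hu), θ.mean_div_sqrt_var hu, mul_add, mul_add,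
    ← mul_assoc, mul_inv_cancel₀ hu.ne']
  linear_combination (θ.c + (θ.c + θ.mu y.ofLp)) * WPhi (√u * θ.A y.ofLp) * θ.sqrt_var_mul hu

theorem integrable_pow_postTy {u : ℝ} (hu : 0 < u) (k : ℕ) :
    Integrable (fun t : ℝ => t ^ k) (θ.postTy y u) :=
  integrable_truncNormal_Ioi (θ.var_pos hu) (integrable_pow_gaussianReal _ _ k)

theorem integral_postBy (w : ℝ × ℝ) (j : Fin q) :
    ∫ b, b j ∂(θ.postBy y w) = w.2 * θ.s j + θ.r y.ofLp j := by
  change ∫ b, b j ∂(multivariateGaussian (WithLp.toLp 2 (w.2 • θ.s + θ.r y.ofLp)) (w.1⁻¹ • θ.B)) = _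
  rw [integral_eval_multivariateGaussian]
  simp

theorem integral_mul_postBy {w : ℝ × ℝ} (hw : 0 < w.1) (j k : Fin q) :
    ∫ b, b j * b k ∂(θ.postBy y w) =
      (w.2 * θ.s j + θ.r y.ofLp j) * (w.2 * θ.s k + θ.r y.ofLp k) + w.1⁻¹ * θ.B j k := by
  change ∫ b, b j * b k
    ∂(multivariateGaussian (WithLp.toLp 2 (w.2 • θ.s + θ.r y.ofLp)) (w.1⁻¹ • θ.B)) = _
  rw [integral_eval_mul_eval_multivariateGaussian (θ.B_posDef.smul (inv_pos.2 hw)).posSemidef]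
  simp

theorem integrable_postBy (w : ℝ × ℝ) (j : Fin q) :
    Integrable (fun b : EuclideanSpace ℝ (Fin q) => b j ^ 2) (θ.postBy y w) :=
  (memLp_eval_multivariateGaussian _ j).integrable_sq

/-- The posterior of `(U, T)`. -/
def postUT : Measure (ℝ × ℝ) := θ.postU y ⊗ₘ θ.postTy y

/-- The posterior of `((U, T), b)`. -/
def postUTB : Measure ((ℝ × ℝ) × EuclideanSpace ℝ (Fin q)) := θ.postUT y ⊗ₘ θ.postBy y

instance : IsFiniteMeasure (θ.postUT y) := by unfold postUT; infer_instance

/-- `postTy` need not be Markov at `u ≤ 0`, but `postU` gives no mass to such `u`. -/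
theorem measurePreserving_fst_postUT : MeasurePreserving Prod.fst (θ.postUT y) (θ.postU y) := by
  refine ⟨measurable_fst, ?_⟩
  ext s hs
  rw [Measure.map_apply measurable_fst hs, postUT, Measure.compProd_apply (measurable_fst hs),
    ← lintegral_indicator_one hs]
  refine lintegral_congr_ae ?_
  filter_upwards [θ.postU_pos y] with u hu
  have : IsProbabilityMeasure (θ.postTy y u) := θ.isProbabilityMeasure_postT hu y
  by_cases h : u ∈ s <;> simp [h, preimage]

theorem measurePreserving_fst_postUTB : MeasurePreserving Prod.fst (θ.postUTB y) (θ.postUT y) :=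
  ⟨measurable_fst, Measure.fst_compProd _ _⟩

theorem postUT_pos : ∀ᵐ w ∂(θ.postUT y), 0 < w.1 :=
  (θ.measurePreserving_fst_postUT y).quasiMeasurePreserving.ae (θ.postU_pos y)

variable {y}

theorem integrable_u_postUT (hu : Integrable (fun u => u) (θ.postU y)) :
    Integrable (fun w => w.1) (θ.postUT y) :=
  (θ.measurePreserving_fst_postUT y).integrable_comp_of_integrable hu

theorem integrable_utt_postUT (hu : Integrable (fun u => u) (θ.postU y))
    [IsProbabilityMeasure (θ.postU y)]
    (hw : Integrable (fun u => √u * WPhi (√u * θ.A y.ofLp)) (θ.postU y)) :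
    Integrable (fun w => w.1 * w.2 ^ 2) (θ.postUT y) := by
  rw [postUT, Measure.integrable_compProd_iff (by fun_prop)]
  refine ⟨?_, ?_⟩
  · filter_upwards [θ.postU_pos y] with u hu
    exact (θ.integrable_pow_postTy y hu 2).const_mul u
  -- For `u > 0` the integrand is nonnegative, so its inner integral equals the closed form of the
  -- truncated second moment, a combination of 1, `u` and the `W_Φ` term.
  · have := ((integrable_const (μ := θ.postU y) (θ.M ^ 2)).add
      (hu.const_mul ((θ.mu y.ofLp + θ.c) ^ 2))).add
      (hw.const_mul (θ.M * (θ.mu y.ofLp + 2 * θ.c)))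
    refine this.congr ?_
    filter_upwards [θ.postU_pos y] with u hu
    simp only [Pi.add_apply]
    rw [← θ.mul_integral_sq_postTy y hu, ← integral_const_mul]
    refine integral_congr_ae (Filter.Eventually.of_forall fun t => ?_)
    simp only [Real.norm_eq_abs]
    rw [abs_of_nonneg (by positivity)]

theorem integrable_ut_postUT (hu : Integrable (fun u => u) (θ.postU y))
    (hutt : Integrable (fun w => w.1 * w.2 ^ 2) (θ.postUT y)) :
    Integrable (fun w => w.1 * w.2) (θ.postUT y) := by
  refine ((θ.integrable_u_postUT hu).norm.add hutt.norm).mono' (by fun_prop)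
    (Filter.Eventually.of_forall fun w => ?_)
  simp only [Pi.add_apply, norm_mul, norm_pow, Real.norm_eq_abs]
  nlinarith [abs_nonneg w.1, abs_nonneg w.2, mul_nonneg (abs_nonneg w.1) (sq_nonneg (|w.2| - 1)),
    mul_nonneg (abs_nonneg w.1) (sq_nonneg |w.2|)]

theorem integral_ut_postUT (hu : Integrable (fun u => u) (θ.postU y))
    (hw : Integrable (fun u => √u * WPhi (√u * θ.A y.ofLp)) (θ.postU y))
    (hut : Integrable (fun w => w.1 * w.2) (θ.postUT y)) :
    ∫ w, w.1 * w.2 ∂(θ.postUT y) = (θ.mu y.ofLp + θ.c) * ∫ u, u ∂(θ.postU y) +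
      θ.M * ∫ u, √u * WPhi (√u * θ.A y.ofLp) ∂(θ.postU y) := by
  rw [← integral_const_mul, ← integral_const_mul, ← integral_add (hu.const_mul _) (hw.const_mul _)]
  rw [postUT] at hut ⊢
  rw [Measure.integral_compProd hut]
  refine integral_congr_ae ?_
  filter_upwards [θ.postU_pos y] with u hu
  rw [← θ.mul_integral_postTy y hu, ← integral_const_mul]

theorem integral_utt_postUT (hu : Integrable (fun u => u) (θ.postU y))
    [IsProbabilityMeasure (θ.postU y)]
    (hw : Integrable (fun u => √u * WPhi (√u * θ.A y.ofLp)) (θ.postU y))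
    (hutt : Integrable (fun w => w.1 * w.2 ^ 2) (θ.postUT y)) :
    ∫ w, w.1 * w.2 ^ 2 ∂(θ.postUT y) =
      θ.M ^ 2 + (θ.mu y.ofLp + θ.c) ^ 2 * ∫ u, u ∂(θ.postU y) +
      θ.M * (θ.mu y.ofLp + 2 * θ.c) * ∫ u, √u * WPhi (√u * θ.A y.ofLp) ∂(θ.postU y) := by
  have h1 : Integrable (fun u => θ.M ^ 2 + (θ.mu y.ofLp + θ.c) ^ 2 * u) (θ.postU y) :=
    (integrable_const _).add (hu.const_mul _)
  have h2 := hw.const_mul (θ.M * (θ.mu y.ofLp + 2 * θ.c))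
  have e : ∫ u, (θ.M ^ 2 + (θ.mu y.ofLp + θ.c) ^ 2 * u +
      θ.M * (θ.mu y.ofLp + 2 * θ.c) * (√u * WPhi (√u * θ.A y.ofLp))) ∂(θ.postU y) =
      θ.M ^ 2 + (θ.mu y.ofLp + θ.c) ^ 2 * ∫ u, u ∂(θ.postU y) +
      θ.M * (θ.mu y.ofLp + 2 * θ.c) * ∫ u, √u * WPhi (√u * θ.A y.ofLp) ∂(θ.postU y) := by
    rw [integral_add h1 h2, integral_add (integrable_const _) (hu.const_mul _), integral_const_mul,
      integral_const_mul, integral_const, probReal_univ, one_smul]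
  rw [← e]
  rw [postUT] at hutt ⊢
  rw [Measure.integral_compProd hutt]
  refine integral_congr_ae ?_
  filter_upwards [θ.postU_pos y] with u hu
  rw [← θ.mul_integral_sq_postTy y hu, ← integral_const_mul]

theorem integrable_ubb_postUTB (hu : Integrable (fun u => u) (θ.postU y))
    (hutt : Integrable (fun w => w.1 * w.2 ^ 2) (θ.postUT y)) (j : Fin q) :
    Integrable (fun z => z.1.1 * z.2 j ^ 2) (θ.postUTB y) := by
  have hut := θ.integrable_ut_postUT hu hutt
  have hu' := θ.integrable_u_postUT hu
  rw [postUTB, Measure.integrable_compProd_iff (by fun_prop)]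
  refine ⟨Filter.Eventually.of_forall fun w => (θ.integrable_postBy y w j).const_mul w.1, ?_⟩
  -- This is `u (t sⱼ + rⱼ)² + Bⱼⱼ`, the inner integral over `b`; the variance `u⁻¹ Bⱼⱼ` contributes
  -- a constant.
  have := ((hutt.const_mul (θ.s j ^ 2)).add (hut.const_mul (2 * θ.s j * θ.r y.ofLp j))).add
    ((hu'.const_mul (θ.r y.ofLp j ^ 2)).add (integrable_const (θ.B j j)))
  refine this.congr ?_
  filter_upwards [θ.postUT_pos y] with w hw
  have e : ∫ b, ‖w.1 * b j ^ 2‖ ∂(θ.postBy y w) = w.1 * ∫ b, b j * b j ∂(θ.postBy y w) := by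
    rw [← integral_const_mul]
    refine integral_congr_ae (Filter.Eventually.of_forall fun t => ?_)
    simp only [Real.norm_eq_abs]
    rw [abs_of_nonneg (by positivity), sq]
  rw [e, θ.integral_mul_postBy y hw]
  simp only [Pi.add_apply]
  field_simp
  ring

end Posterior

end SMSNLMM

/-! ### Moments involving the random effects, and the full set of identities -/

theorem MeasureTheory.MeasurePreserving.integral_comp_of_measurable {α β : Type*}
    [MeasurableSpace α] [MeasurableSpace β] {μ : Measure α} {ν : Measure β} {f : α → β}
    (hf : MeasurePreserving f μ ν) {g : β → ℝ} (hg : Measurable g) :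
    ∫ x, g (f x) ∂μ = ∫ y, g y ∂ν := by
  rw [← hf.map_eq, integral_map hf.measurable.aemeasurable hg.aestronglyMeasurable]

namespace SMSNLMM

variable {n l q : ℕ} (θ : SMSNLMM n l q)

section Posterior

variable {y : EuclideanSpace ℝ (Fin n)}

theorem integral_ub_postUTB (hu : Integrable (fun w => w.1) (θ.postUT y))
    (hut : Integrable (fun w => w.1 * w.2) (θ.postUT y)) (j : Fin q)
    (hub : Integrable (fun z => z.1.1 * z.2 j) (θ.postUTB y)) :
    ∫ z, z.1.1 * z.2 j ∂(θ.postUTB y) =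
      (∫ w, w.1 ∂(θ.postUT y)) * θ.r y.ofLp j + (∫ w, w.1 * w.2 ∂(θ.postUT y)) * θ.s j := by
  rw [← integral_mul_const, ← integral_mul_const,
    ← integral_add (hu.mul_const _) (hut.mul_const _)]
  rw [postUTB] at hub ⊢
  rw [Measure.integral_compProd hub]
  refine integral_congr_ae (Filter.Eventually.of_forall fun w => ?_)
  simp only
  rw [integral_const_mul, integral_postBy]
  ring

theorem integral_utb_postUTB (hut : Integrable (fun w => w.1 * w.2) (θ.postUT y))
    (hutt : Integrable (fun w => w.1 * w.2 ^ 2) (θ.postUT y)) (j : Fin q)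
    (hutb : Integrable (fun z => z.1.1 * z.1.2 * z.2 j) (θ.postUTB y)) :
    ∫ z, z.1.1 * z.1.2 * z.2 j ∂(θ.postUTB y) =
      (∫ w, w.1 * w.2 ∂(θ.postUT y)) * θ.r y.ofLp j +
        (∫ w, w.1 * w.2 ^ 2 ∂(θ.postUT y)) * θ.s j := by
  rw [← integral_mul_const, ← integral_mul_const,
    ← integral_add (hut.mul_const _) (hutt.mul_const _)]
  rw [postUTB] at hutb ⊢
  rw [Measure.integral_compProd hutb]
  refine integral_congr_ae (Filter.Eventually.of_forall fun w => ?_)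
  simp only
  rw [integral_const_mul, integral_postBy]
  ring

theorem integral_ubb_postUTB [IsProbabilityMeasure (θ.postUT y)]
    (hu : Integrable (fun w => w.1) (θ.postUT y))
    (hut : Integrable (fun w => w.1 * w.2) (θ.postUT y))
    (hutt : Integrable (fun w => w.1 * w.2 ^ 2) (θ.postUT y)) (j k : Fin q)
    (hubb : Integrable (fun z => z.1.1 * (z.2 j * z.2 k)) (θ.postUTB y)) :
    ∫ z, z.1.1 * (z.2 j * z.2 k) ∂(θ.postUTB y) =
      θ.B j k + (∫ w, w.1 ∂(θ.postUT y)) * (θ.r y.ofLp j * θ.r y.ofLp k) +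
        (∫ w, w.1 * w.2 ∂(θ.postUT y)) * (θ.s j * θ.r y.ofLp k + θ.r y.ofLp j * θ.s k) +
        (∫ w, w.1 * w.2 ^ 2 ∂(θ.postUT y)) * (θ.s j * θ.s k) := by
  have h1 := hu.mul_const (θ.r y.ofLp j * θ.r y.ofLp k)
  have h2 := hut.mul_const (θ.s j * θ.r y.ofLp k + θ.r y.ofLp j * θ.s k)
  have h3 := hutt.mul_const (θ.s j * θ.s k)
  have h01 : Integrable (fun w : ℝ × ℝ => θ.B j k + w.1 * (θ.r y.ofLp j * θ.r y.ofLp k))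
      (θ.postUT y) := (integrable_const _).add h1
  have h02 : Integrable (fun w : ℝ × ℝ => θ.B j k + w.1 * (θ.r y.ofLp j * θ.r y.ofLp k) +
      w.1 * w.2 * (θ.s j * θ.r y.ofLp k + θ.r y.ofLp j * θ.s k)) (θ.postUT y) := h01.add h2
  have e : ∫ w, (θ.B j k + w.1 * (θ.r y.ofLp j * θ.r y.ofLp k) +
      w.1 * w.2 * (θ.s j * θ.r y.ofLp k + θ.r y.ofLp j * θ.s k) +
      w.1 * w.2 ^ 2 * (θ.s j * θ.s k)) ∂(θ.postUT y) =
      θ.B j k + (∫ w, w.1 ∂(θ.postUT y)) * (θ.r y.ofLp j * θ.r y.ofLp k) +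
        (∫ w, w.1 * w.2 ∂(θ.postUT y)) * (θ.s j * θ.r y.ofLp k + θ.r y.ofLp j * θ.s k) +
        (∫ w, w.1 * w.2 ^ 2 ∂(θ.postUT y)) * (θ.s j * θ.s k) := by
    rw [integral_add h02 h3, integral_add h01 h2, integral_add (integrable_const _) h1,
      integral_mul_const, integral_mul_const, integral_mul_const, integral_const, probReal_univ,
      one_smul]
  rw [← e]
  rw [postUTB] at hubb ⊢
  rw [Measure.integral_compProd hubb]
  refine integral_congr_ae ?_
  filter_upwards [θ.postUT_pos y] with w hw
  -- The factor `u` cancels `u⁻¹` in the covariance, which is why `B` appears without the weight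
  -- `û`.
  rw [integral_const_mul, θ.integral_mul_postBy y hw]
  field_simp
  ring

theorem posterior_moments (hy : y.ofLp ≠ θ.loc) (h0 : θ.margDens y ≠ 0) (hπ : θ.margDens y ≠ ⊤)
    {Q : Measure (ℝ × ℝ × EuclideanSpace ℝ (Fin q))} (hQ : Q = θ.postAll y) :
    (Integrable (fun z => z.1) Q ∧
      Integrable (fun z => z.1 * z.2.1) Q ∧
      Integrable (fun z => z.1 * z.2.1 ^ 2) Q ∧
      (∀ j, Integrable (fun z => z.1 * z.2.2 j) Q) ∧
      (∀ j, Integrable (fun z => z.1 * z.2.1 * z.2.2 j) Q) ∧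
      (∀ j k, Integrable (fun z => z.1 * (z.2.2 j * z.2.2 k)) Q) ∧
      Integrable (fun z => Real.sqrt z.1 * WPhi (Real.sqrt z.1 * θ.A y.ofLp)) Q) ∧
    utHat Q = (θ.mu y.ofLp + θ.c) * uHat Q + θ.M * tauOneHat Q (θ.A y.ofLp) ∧
    utSqHat Q = θ.M ^ 2 + (θ.mu y.ofLp + θ.c) ^ 2 * uHat Q +
      θ.M * (θ.mu y.ofLp + 2 * θ.c) * tauOneHat Q (θ.A y.ofLp) ∧
    ubHat Q = uHat Q • θ.r y.ofLp + utHat Q • θ.s ∧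
    utbHat Q = utHat Q • θ.r y.ofLp + utSqHat Q • θ.s ∧
    ubbHat Q = θ.B + uHat Q • Matrix.vecMulVec (θ.r y.ofLp) (θ.r y.ofLp) +
      utHat Q • (Matrix.vecMulVec θ.s (θ.r y.ofLp) + Matrix.vecMulVec (θ.r y.ofLp) θ.s) +
      utSqHat Q • Matrix.vecMulVec θ.s θ.s := by
  have hprob : IsProbabilityMeasure (θ.postU y) :=
    ⟨by rw [postU_univ, ENNReal.inv_mul_cancel h0 hπ]⟩
  have p1 := θ.measurePreserving_fst_postUT y
  have p2 := θ.measurePreserving_fst_postUTB y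
  have hprob2 : IsProbabilityMeasure (θ.postUT y) :=
    ⟨by simpa using p1.measure_preimage (MeasurableSet.univ).nullMeasurableSet⟩
  have p3 : MeasurePreserving (MeasurableEquiv.prodAssoc (α := ℝ) (β := ℝ)
      (γ := EuclideanSpace ℝ (Fin q))) (θ.postUTB y) Q :=
    ⟨MeasurableEquiv.measurable _, by rw [hQ, postAll_apply]; rfl⟩
  have hu := θ.integrable_id_postU hy h0
  have hw := θ.integrable_WPhi_postU hy h0
  have iu := θ.integrable_u_postUT hu
  have iutt := θ.integrable_utt_postUT hu hw
  have iut := θ.integrable_ut_postUT hu iutt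
  have iw : Integrable (fun w => √w.1 * WPhi (√w.1 * θ.A y.ofLp)) (θ.postUT y) :=
    p1.integrable_comp_of_integrable hw
  have ju : Integrable (fun z => z.1.1) (θ.postUTB y) := p2.integrable_comp_of_integrable iu
  have jut : Integrable (fun z => z.1.1 * z.1.2) (θ.postUTB y) :=
    p2.integrable_comp_of_integrable iut
  have jutt : Integrable (fun z => z.1.1 * z.1.2 ^ 2) (θ.postUTB y) :=
    p2.integrable_comp_of_integrable iutt
  have jw : Integrable (fun z => √z.1.1 * WPhi (√z.1.1 * θ.A y.ofLp)) (θ.postUTB y) :=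
    p2.integrable_comp_of_integrable iw
  have jbb := θ.integrable_ubb_postUTB hu iutt
  -- This dominates every mixed moment by pure second moments weighted by `u`; the choice `b = 1`
  -- covers the first moment of the random effects.
  have key : ∀ a b c : ℝ, |a| * (|b| * |c|) ≤ |a| * |b| ^ 2 + |a| * |c| ^ 2 := fun a b c => by
    rw [← mul_add]
    gcongr
    nlinarith [sq_nonneg (|b| - |c|), sq_nonneg |b|, sq_nonneg |c|]
  have jb : ∀ j, Integrable (fun z => z.1.1 * z.2 j) (θ.postUTB y) := fun j => by
    refine (ju.norm.add (jbb j).norm).mono' (by fun_prop)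
      (Filter.Eventually.of_forall fun z => ?_)
    simpa using key z.1.1 1 (z.2 j)
  have jtb : ∀ j, Integrable (fun z => z.1.1 * z.1.2 * z.2 j) (θ.postUTB y) := fun j => by
    refine (jutt.norm.add (jbb j).norm).mono' (by fun_prop)
      (Filter.Eventually.of_forall fun z => ?_)
    simpa [mul_assoc] using key z.1.1 z.1.2 (z.2 j)
  have jjk : ∀ j k, Integrable (fun z => z.1.1 * (z.2 j * z.2 k)) (θ.postUTB y) := fun j k => by
    refine ((jbb j).norm.add (jbb k).norm).mono' (by fun_prop)
      (Filter.Eventually.of_forall fun z => ?_)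
    simpa using key z.1.1 (z.2 j) (z.2 k)
  have tr : ∀ {g : ℝ × ℝ × EuclideanSpace ℝ (Fin q) → ℝ},
      Integrable (fun z => g (z.1.1, z.1.2, z.2)) (θ.postUTB y) → Integrable g Q := fun {g} hg =>
    (p3.integrable_comp_emb (MeasurableEquiv.measurableEmbedding _)).1 hg
  have ti : ∀ g : ℝ × ℝ × EuclideanSpace ℝ (Fin q) → ℝ,
      ∫ z, g z ∂Q = ∫ z, g (z.1.1, z.1.2, z.2) ∂(θ.postUTB y) := fun g =>
    (p3.integral_comp (MeasurableEquiv.measurableEmbedding _) g).symm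
  have eu : uHat Q = ∫ w, w.1 ∂(θ.postUT y) := by
    rw [uHat, ti]
    exact p2.integral_comp_of_measurable (g := fun w => w.1) (by fun_prop)
  have eut : utHat Q = ∫ w, w.1 * w.2 ∂(θ.postUT y) := by
    rw [utHat, ti]
    exact p2.integral_comp_of_measurable (g := fun w => w.1 * w.2) (by fun_prop)
  have eutt : utSqHat Q = ∫ w, w.1 * w.2 ^ 2 ∂(θ.postUT y) := by
    rw [utSqHat, ti]
    exact p2.integral_comp_of_measurable (g := fun w => w.1 * w.2 ^ 2) (by fun_prop)
  have euU : uHat Q = ∫ u, u ∂(θ.postU y) := by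
    rw [eu]
    exact p1.integral_comp_of_measurable (g := fun u => u) (by fun_prop)
  have eτ : tauOneHat Q (θ.A y.ofLp) = ∫ u, √u * WPhi (√u * θ.A y.ofLp) ∂(θ.postU y) := by
    rw [tauOneHat, ti]
    refine (p2.integral_comp_of_measurable
      (g := fun w => √w.1 * WPhi (√w.1 * θ.A y.ofLp)) (by fun_prop)).trans ?_
    exact p1.integral_comp_of_measurable (g := fun u => √u * WPhi (√u * θ.A y.ofLp)) (by fun_prop)
  refine ⟨⟨tr ju, tr jut, tr jutt, fun j => tr (jb j), fun j => tr (jtb j),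
    fun j k => tr (jjk j k), tr jw⟩, ?_, ?_, ?_, ?_, ?_⟩
  · rw [eut, euU, eτ, θ.integral_ut_postUT hu hw iut]
  · rw [eutt, euU, eτ, θ.integral_utt_postUT hu hw iutt]
  · ext j
    rw [ubHat, ti, θ.integral_ub_postUTB iu iut j (jb j), eu, eut]
    rfl
  · ext j
    rw [utbHat, ti, θ.integral_utb_postUTB iut iutt j (jtb j), eut, eutt]
    rfl
  · ext j k
    rw [ubbHat, Matrix.of_apply, ti, θ.integral_ubb_postUTB iu iut iutt j k (jjk j k), eu, eut,
      eutt]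
    rfl

end Posterior

end SMSNLMM

end

/-! ### The main theorem -/

theorem mainTheorem3 {n l q : ℕ} (hn : 0 < n) (θ : SMSNLMM n l q)
    {Ω : Type*} [MeasurableSpace Ω] (P : Measure Ω) [IsProbabilityMeasure P]
    (U T : Ω → ℝ) (b : Ω → EuclideanSpace ℝ (Fin q)) (Y : Ω → EuclideanSpace ℝ (Fin n))
    (h : θ.IsModel P U T b Y) :
    -- conditional distribution of `b` given `T`, `U`, `Y`
    CondLaw b (fun ω => (T ω, U ω, Y ω)) P (fun w =>
      multivariateGaussian (WithLp.toLp 2 (w.1 • θ.s + θ.r w.2.2.ofLp)) (w.2.1⁻¹ • θ.B)) ∧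
    -- conditional distribution of `T` given `U`, `Y`
    CondLaw T (fun ω => (U ω, Y ω)) P (fun w =>
      truncNormal (θ.c + θ.mu w.2.ofLp) (w.1⁻¹ * θ.M ^ 2) (Ioi θ.c)) ∧
    -- marginal distribution of `Y`
    P.map Y = smsn θ.loc θ.Psi θ.lamBar θ.H ∧
    -- the two expressions of `A`
    (∀ y : Fin n → ℝ,
      θ.A y = θ.lamBar ⬝ᵥ ((CFC.sqrt θ.Psi)⁻¹ *ᵥ (y - θ.loc))) ∧
    -- conditional moments given `Y = y`
    ∀ᵐ y ∂(P.map Y), ∀ Q : Measure (ℝ × ℝ × EuclideanSpace ℝ (Fin q)),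
      Q = condLatent P U T b Y y →
      -- they exist
      (Integrable (fun z => z.1) Q ∧
        Integrable (fun z => z.1 * z.2.1) Q ∧
        Integrable (fun z => z.1 * z.2.1 ^ 2) Q ∧
        (∀ j, Integrable (fun z => z.1 * z.2.2 j) Q) ∧
        (∀ j, Integrable (fun z => z.1 * z.2.1 * z.2.2 j) Q) ∧
        (∀ j k, Integrable (fun z => z.1 * (z.2.2 j * z.2.2 k)) Q) ∧
        Integrable (fun z => Real.sqrt z.1 * WPhi (Real.sqrt z.1 * θ.A y.ofLp)) Q) ∧
      -- and are given by
      utHat Q = (θ.mu y.ofLp + θ.c) * uHat Q + θ.M * tauOneHat Q (θ.A y.ofLp) ∧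
      utSqHat Q = θ.M ^ 2 + (θ.mu y.ofLp + θ.c) ^ 2 * uHat Q +
        θ.M * (θ.mu y.ofLp + 2 * θ.c) * tauOneHat Q (θ.A y.ofLp) ∧
      ubHat Q = uHat Q • θ.r y.ofLp + utHat Q • θ.s ∧
      utbHat Q = utHat Q • θ.r y.ofLp + utSqHat Q • θ.s ∧
      ubbHat Q = θ.B + uHat Q • Matrix.vecMulVec (θ.r y.ofLp) (θ.r y.ofLp) +
        utHat Q • (Matrix.vecMulVec θ.s (θ.r y.ofLp) + Matrix.vecMulVec (θ.r y.ofLp) θ.s) +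
        utSqHat Q • Matrix.vecMulVec θ.s θ.s := by
  refine ⟨h.condLaw_b, h.condLaw_T, by rw [h.map_Y, θ.smsn_eq], θ.A_eq, ?_⟩
  -- With at least one observation Lebesgue measure has no atoms, so the exceptional point where the
  -- Mahalanobis distance vanishes is null.
  have : Nonempty (Fin n) := ⟨⟨0, hn⟩⟩
  have hloc : ∀ᵐ y ∂(P.map Y), y ≠ WithLp.toLp 2 θ.loc := by
    rw [h.map_Y]
    exact (withDensity_absolutelyContinuous _ _).ae_le (Measure.ae_ne volume _)
  have htop : ∀ᵐ y ∂(P.map Y), θ.margDens y < ⊤ := by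
    rw [h.map_Y]
    exact (withDensity_absolutelyContinuous _ _).ae_le h.ae_margDens_lt_top
  have hzero : ∀ᵐ y ∂(P.map Y), θ.margDens y ≠ 0 := by
    rw [h.map_Y, ae_withDensity_iff θ.measurable_margDens]
    exact Filter.Eventually.of_forall fun y hy => hy
  have hlaw : ∀ᵐ y ∂(P.map Y), condLatent P U T b Y y = θ.postAll y := h.condLaw_latent
  filter_upwards [hloc, htop, hzero, hlaw] with y h1 h2 h3 h4 Q hQ
  exact θ.posterior_moments (fun he => h1 (by rw [← he])) h3 h2.ne (hQ.trans h4)
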